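/- Let $V,H$ be separable Hilbert spaces over $\mathbb K=\mathbb R$ or $\mathbb C$ with $V$ continuously and densely embedded in $H$, let $V'$ be the space of bounded antilinear functionals on $V$ with duality $\langle\cdot,\cdot\rangle$, and embed $H$ in $V'$ by $\langle x,v\rangle=(x\mid v)_H$. Let $T>0$ and let $\mathfrak a:[0,T]\times V\times V\to\mathbb K$ be a non-autonomous closed form; that is, $\mathfrak a(t,\cdot,\cdot)$ is sesquilinear for every $t\in[0,T]$ (antilinear in the second variable), $\mathfrak a(\cdot,u,v)$ is measurable for all $u,v\in V$, and there are constants $M,\omega\in\mathbb R$ and $\alpha>0$ with \[ |\mathfrak a(t,u,v)|\le M\|u\|_V\|v\|_V,\qquad \operatorname{Re}\mathfrak a(t,u,u)+\omega\|u\|_H^2\ge\alpha\|u\|_V^2\qquad(t\in[0,T],\ u,v\in V). \] Let $\mathcal A(t):V\to V'$ be given by $\langle\mathcal A(t)u,v\rangle=\mathfrak a(t,u,v)$. Let $f\in L^2(0,T;V')$, and let $\mathcal C\subset H$ be nonempty, closed and convex, with orthogonal projection $P:H\to\mathcal C$ satisfying $P(V)\subset V$. Suppose that for every $v\in V$ and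 almost every $t\in[0,T]$, \[ \operatorname{Re}\mathfrak a(t,Pv,v-Pv)\ge\operatorname{Re}\langle f(t),v-Pv\rangle . \] Then $\mathcal C$ is invariant for the equation $\dot u+\mathcal A(t)u=f$: every $u\in H^1(0,T;V')\cap L^2(0,T;V)$ that satisfies $\dot u(t)+\mathcal A(t)u(t)=f(t)$ for almost every $t\in(0,T)$ has a representative in $C([0,T];H)$, again denoted by $u$, and if $u(0)\in\mathcal C$, then $u(t)\in\mathcal C$ for all $t\in[0,T]$. -/

import Mathlib

open MeasureTheory Set

/-- The space `V'` of bounded antilinear functionals on `V`, with its operator norm. The duality is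
`⟨f, v⟩ = f v`, linear in `f` and antilinear in `v`, like a sesquilinear form. For `𝕜 = ℝ` this is
the usual dual space. -/
abbrev Antidual (𝕜 V : Type*) [RCLike 𝕜] [NormedAddCommGroup V] [InnerProductSpace 𝕜 V] : Type _ :=
  V →L⋆[𝕜] 𝕜

section Projection

variable {𝕜 H : Type*} [RCLike 𝕜] [NormedAddCommGroup H] [InnerProductSpace 𝕜 H]

/-- `p` is the orthogonal projection of `x` onto `C`: `p ∈ C` and `Re (x - p | y - p) ≤ 0` for all
`y ∈ C`. -/
def IsProjPoint (𝕜 : Type*) {H : Type*} [RCLike 𝕜] [NormedAddCommGroup H] [InnerProductSpace 𝕜 H]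
    (C : Set H) (x p : H) : Prop :=
  p ∈ C ∧ ∀ y ∈ C, RCLike.re (inner 𝕜 (x - p) (y - p)) ≤ 0

/-- The orthogonal projection `P : H → C` onto a nonempty closed convex set `C`
(see `convexProj_spec` and `IsProjPoint.unique`). -/
noncomputable def convexProj (𝕜 : Type*) {H : Type*} [RCLike 𝕜] [NormedAddCommGroup H]
    [InnerProductSpace 𝕜 H] (C : Set H) (x : H) : H :=
  Classical.epsilon (IsProjPoint 𝕜 C x)

theorem IsProjPoint.unique {C : Set H} {x p q : H} (hp : IsProjPoint 𝕜 C x p)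
    (hq : IsProjPoint 𝕜 C x q) : p = q := by
  have h1 := hp.2 q hq.1
  have h2 := hq.2 p hp.1
  have h3 : RCLike.re (inner 𝕜 (q - p) (q - p)) =
      RCLike.re (inner 𝕜 (x - p) (q - p)) + RCLike.re (inner 𝕜 (x - q) (p - q)) := by
    have e : inner 𝕜 (x - q) (p - q) = - inner 𝕜 (x - q) (q - p) := by
      rw [← inner_neg_right, neg_sub]
    rw [e, ← map_add, ← sub_eq_add_neg, ← inner_sub_left]
    congr 2
    abel
  rw [inner_self_eq_norm_sq] at h3
  have h4 : ‖q - p‖ = 0 := by nlinarith [norm_nonneg (q - p)]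
  exact (sub_eq_zero.1 (norm_eq_zero.1 h4)).symm

theorem convexProj_spec [CompleteSpace H] [NormedSpace ℝ H] [IsScalarTower ℝ 𝕜 H] {C : Set H}
    (hne : C.Nonempty) (hcl : IsClosed C) (hcv : Convex ℝ C) (x : H) :
    IsProjPoint 𝕜 C x (convexProj 𝕜 C x) := by
  have key : ∃ p, IsProjPoint 𝕜 C x p := by
    have hcv' : ∀ y ∈ C, ∀ z ∈ C, ∀ a b : ℝ, 0 ≤ a → 0 ≤ b → a + b = 1 →
        (a : 𝕜) • y + (b : 𝕜) • z ∈ C := by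
      intro y hy z hz a b ha hb hab
      have := hcv hy hz ha hb hab
      rwa [← algebraMap_smul 𝕜 a y, ← algebraMap_smul 𝕜 b z] at this
    clear hcv
    rename_i i1 i2
    clear i2 i1
    let := InnerProductSpace.rclikeToReal 𝕜 H
    have hc : Convex ℝ C := fun y hy z hz a b ha hb hab => hcv' y hy z hz a b ha hb hab
    obtain ⟨p, hp, he⟩ := exists_norm_eq_iInf_of_complete_convex hne hcl.isComplete hc x
    exact ⟨p, hp, (norm_eq_iInf_iff_real_inner_le_zero hc hp).1 he⟩
  exact Classical.epsilon_spec key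

end Projection

section Evolution

variable {𝕜 V H : Type*} [RCLike 𝕜]
  [NormedAddCommGroup V] [InnerProductSpace 𝕜 V]
  [NormedAddCommGroup H] [InnerProductSpace 𝕜 H]

/-- The map `H → V'`, `⟨x, v⟩ = (x | j v)_H` (Mathlib's inner product is antilinear in its first
argument), induced by the embedding `j : V → H`. -/
noncomputable def toAntidual (j : V →L[𝕜] H) (x : H) : Antidual 𝕜 V :=
  (innerSLFlip 𝕜 x).comp j

@[simp] theorem toAntidual_apply (j : V →L[𝕜] H) (x : H) (v : V) :
    toAntidual j x v = inner 𝕜 (j v) x := rfl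

/-- A non-autonomous closed form `𝔞 : [0,T] × V × V → 𝕜`, `𝔞(t,u,v) = a t u v`; only the values
for `t ∈ [0,T]` matter. Each `a t` is a bounded sesquilinear form, linear in the first and
antilinear in the second variable; read as a map `V → V'`, it is the associated operator `𝒜(t)`. -/
structure IsNonautonomousClosedForm (j : V →L[𝕜] H) (T : ℝ) (a : ℝ → V →L[𝕜] Antidual 𝕜 V) :
    Prop where
  bounded : ∃ M : ℝ, ∀ t ∈ Icc 0 T, ∀ u v : V, ‖a t u v‖ ≤ M * ‖u‖ * ‖v‖
  quasiCoercive : ∃ ω α : ℝ, 0 < α ∧ ∀ t ∈ Icc 0 T, ∀ u : V,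
    α * ‖u‖ ^ 2 ≤ RCLike.re (a t u u) + ω * ‖j u‖ ^ 2
  /-- Lebesgue measurability of `t ↦ 𝔞(t,u,v)` on `[0,T]`. -/
  measurable : ∀ u v : V, AEStronglyMeasurable (fun t => a t u v) (volume.restrict (Icc 0 T))

/-- `u'` is the weak derivative of `u` on `(0,T)`:
`-∫ u φ' = ∫ u' φ` for all scalar-valued `φ ∈ C_c^∞(0,T)`. -/
def HasWeakDeriv {E : Type*} [NormedAddCommGroup E] [NormedSpace ℝ E] (T : ℝ) (u u' : ℝ → E) :
    Prop :=
  ∀ φ : ℝ → ℝ, ContDiff ℝ (⊤ : ℕ∞) φ → HasCompactSupport φ → tsupport φ ⊆ Ioo 0 T →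
    -∫ t in Ioo 0 T, deriv φ t • u t = ∫ t in Ioo 0 T, φ t • u' t

/-- `u ∈ MR(V,V') = H¹(0,T;V') ∩ L²(0,T;V)` (that is, `u ∈ L²(0,T;V)` has a weak derivative
`u' ∈ L²(0,T;V')`) and `u' + 𝒜(t) u = f` almost everywhere on `(0,T)`. -/
def IsSolution (j : V →L[𝕜] H) (T : ℝ) (a : ℝ → V →L[𝕜] Antidual 𝕜 V) (f : ℝ → Antidual 𝕜 V)
    (u : ℝ → V) : Prop :=
  MemLp u 2 (volume.restrict (Ioo 0 T)) ∧
  ∃ u' : ℝ → Antidual 𝕜 V,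
    MemLp u' 2 (volume.restrict (Ioo 0 T)) ∧
    HasWeakDeriv T (fun t => toAntidual j (j (u t))) u' ∧
    ∀ᵐ t ∂volume.restrict (Ioo 0 T), u' t + a t (u t) = f t

/-- `w` is the representative of `u` in `C([0,T];H)`. -/
def IsContinuousRep (j : V →L[𝕜] H) (T : ℝ) (u : ℝ → V) (w : ℝ → H) : Prop :=
  ContinuousOn w (Icc 0 T) ∧ ∀ᵐ t ∂volume.restrict (Ioo 0 T), w t = j (u t)

/-- `C` is invariant for the Cauchy problem `u' + 𝒜(t) u = f`, `u(0) = u₀`: every solution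
`u ∈ MR(V,V')` has a (necessarily unique) representative `w ∈ C([0,T];H)`, and if its initial
value `w(0)` is in `C`, then `w(t) ∈ C` for all `t ∈ [0,T]`. -/
def IsInvariantFor (j : V →L[𝕜] H) (T : ℝ) (a : ℝ → V →L[𝕜] Antidual 𝕜 V)
    (f : ℝ → Antidual 𝕜 V) (C : Set H) : Prop :=
  ∀ u : ℝ → V, IsSolution j T a f u →
    ∃ w : ℝ → H, IsContinuousRep j T u w ∧ (w 0 ∈ C → ∀ t ∈ Icc 0 T, w t ∈ C)

end Evolution

/-!
# Invariance of closed convex sets for non-autonomous evolution equations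

Let `u` be a solution and `z = u - Pu`. The function `x ↦ ‖x - P x‖² / 2` on `H` is convex with
gradient `x - P x`, so `ψ = ‖u - Pu‖² / 2` should satisfy `ψ' = Re ⟨u', u - Pu⟩`. The equation and
the criterion turn the right-hand side into at most `-Re 𝔞(z, z)`, which is at most `2 |ω| ψ` by
quasi-coercivity (`re_apply_sub_le_of_criterion`). Gronwall's lemma (`eq_zero_of_sub_le_integral`)
then gives `ψ = 0`.

The derivative formula is `energy_identity`, in integrated form. It needs only the subgradient
inequality `ψ τ - ψ σ ≤ Re ⟨∫_σ^τ u', z τ⟩` for almost all `σ`, `τ`, which is divided by `τ - σ`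
and integrated, so `Pu` need not have a weak derivative. Applied to `ψ = ‖u‖² / 2`, the same
identity yields the representative in `C([0,T];H)` (`exists_continuous_representative`), starting
from `HasWeakDeriv.exists_ae_eq_add_integral`, by which `u` is a primitive of its weak derivative.

To use the identity for `z = u - Pu`, one needs `Pu ∈ L²(0,T;V)`. Measurability holds because the
embedding of `V` in `H` is a measurable embedding (`measurable_lift`), and the bound comes from
the criterion at `v = u t` (`memLp_of_criterion`). There the criterion has to hold for all `v` at almost every `t`; the
exchange of quantifiers is `ae_forall_criterion`, which rests on weak convergence in `V`.
-/

/-! ### Difference quotients and the energy identity -/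

section DifferenceQuotients

open Filter Topology

theorem HasDerivAt.tendsto_backward_quotient {E : Type*} [NormedAddCommGroup E] [NormedSpace ℝ E]
    {f : ℝ → E} {f' : E} {x : ℝ} (hf : HasDerivAt f f' x) :
    Tendsto (fun h : ℝ => h⁻¹ • (f x - f (x - h))) (𝓝[≠] 0) (𝓝 f') := by
  have h1 := hasDerivAt_iff_tendsto_slope_zero.1 hf
  have h2 : Tendsto (fun h : ℝ => -h) (𝓝[≠] 0) (𝓝[≠] 0) := by
    refine tendsto_nhdsWithin_iff.2 ⟨?_, ?_⟩
    · have : Tendsto (fun h : ℝ => -h) (𝓝 0) (𝓝 (-0)) := (continuous_neg (G := ℝ)).tendsto 0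
      rw [neg_zero] at this
      exact this.mono_left nhdsWithin_le_nhds
    · filter_upwards [self_mem_nhdsWithin] with h hh
      simpa using hh
  refine (h1.comp h2).congr fun h => ?_
  simp only [Function.comp]
  rw [inv_neg, neg_smul, ← smul_neg, neg_sub, ← sub_eq_add_neg]

theorem MeasureTheory.LocallyIntegrable.intervalIntegrable {E : Type*} [NormedAddCommGroup E]
    {f : ℝ → E} (hf : LocallyIntegrable f volume) (a b : ℝ) : IntervalIntegrable f volume a b :=
  intervalIntegrable_iff.mpr <|
    (hf.integrableOn_isCompact isCompact_uIcc).mono_set uIoc_subset_uIcc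

/-- Integrated difference quotients of `ψ` converge to the increment of `ψ` between two points at
which the primitive of `ψ` is differentiable with derivative `ψ`. -/
theorem tendsto_integral_backward_quotient {ψ : ℝ → ℝ} (hψ : LocallyIntegrable ψ volume) {s t : ℝ}
    (hs : HasDerivAt (fun x => ∫ r in (0 : ℝ)..x, ψ r) (ψ s) s)
    (ht : HasDerivAt (fun x => ∫ r in (0 : ℝ)..x, ψ r) (ψ t) t) :
    Tendsto (fun h : ℝ => ∫ τ in s..t, h⁻¹ * (ψ τ - ψ (τ - h))) (𝓝[≠] 0) (𝓝 (ψ t - ψ s)) := by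
  refine (ht.tendsto_backward_quotient.sub hs.tendsto_backward_quotient).congr fun h => ?_
  have hi := hψ.intervalIntegrable
  rw [intervalIntegral.integral_const_mul, intervalIntegral.integral_sub (hi _ _)
    (by simpa using (hi (s - h) (t - h)).comp_sub_right h),
    intervalIntegral.integral_comp_sub_right (fun x => ψ x) h, smul_eq_mul, smul_eq_mul, ← mul_sub]
  congr 1
  have e1 := intervalIntegral.integral_interval_sub_left (hi 0 t) (hi 0 s)
  have e2 := intervalIntegral.integral_interval_sub_left (hi 0 (t - h)) (hi 0 (s - h))
  rw [← e1, ← e2]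
  ring

/-- The square of the norm of an average is at most the average of the squares. The increment `h`
may have either sign. -/
theorem norm_sq_average_le {E : Type*} [NormedAddCommGroup E] [NormedSpace ℝ E]
    {g : ℝ → E} (hg : LocallyIntegrable g volume)
    (hg2 : LocallyIntegrable (fun x => ‖g x‖ ^ 2) volume) (τ : ℝ) {h : ℝ} (hh : h ≠ 0) :
    ‖h⁻¹ • ∫ r in (τ - h)..τ, g r‖ ^ 2 ≤ h⁻¹ * ∫ r in (τ - h)..τ, ‖g r‖ ^ 2 := by
  have key : ∀ a b : ℝ, a < b → ‖∫ r in a..b, g r‖ ^ 2 ≤ (b - a) * ∫ r in a..b, ‖g r‖ ^ 2 := by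
    intro a b hab
    have h1 : ‖∫ r in a..b, g r‖ ≤ ∫ r in a..b, ‖g r‖ :=
      intervalIntegral.norm_integral_le_integral_norm hab.le
    set m := ∫ r in a..b, ‖g r‖ with hm
    have hi := (hg.intervalIntegrable a b).norm
    have hi2 := hg2.intervalIntegrable a b
    have h2 : 0 ≤ ∫ r in a..b, (‖g r‖ ^ 2 - 2 * (m / (b - a)) * ‖g r‖ + (m / (b - a)) ^ 2) := by
      refine intervalIntegral.integral_nonneg hab.le fun r _ => ?_
      nlinarith [sq_nonneg (‖g r‖ - m / (b - a))]
    rw [intervalIntegral.integral_add (hi2.sub (hi.const_mul _)) (by simp),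
      intervalIntegral.integral_sub hi2 (hi.const_mul _), intervalIntegral.integral_const_mul,
      ← hm, intervalIntegral.integral_const, smul_eq_mul] at h2
    have h3 : 0 < b - a := sub_pos.2 hab
    have h4 : (b - a) * (2 * (m / (b - a)) * m) = 2 * m ^ 2 := by field_simp
    have h5 : (b - a) * ((b - a) * (m / (b - a)) ^ 2) = m ^ 2 := by field_simp
    have h6 := mul_nonneg h3.le h2
    have h7 : ‖∫ r in a..b, g r‖ ^ 2 ≤ m ^ 2 := by gcongr
    nlinarith
  rw [norm_smul, mul_pow, Real.norm_eq_abs, sq_abs]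
  rcases lt_or_gt_of_ne hh with hneg | hpos
  · have := key τ (τ - h) (by linarith)
    rw [intervalIntegral.integral_symm, norm_neg,
      intervalIntegral.integral_symm (f := fun r => ‖g r‖ ^ 2)]
    calc h⁻¹ ^ 2 * ‖∫ r in τ..(τ - h), g r‖ ^ 2
        ≤ h⁻¹ ^ 2 * ((τ - h - τ) * ∫ r in τ..(τ - h), ‖g r‖ ^ 2) := by gcongr
      _ = _ := by field_simp; ring
  · have := key (τ - h) τ (by linarith)
    calc h⁻¹ ^ 2 * ‖∫ r in (τ - h)..τ, g r‖ ^ 2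
        ≤ h⁻¹ ^ 2 * ((τ - (τ - h)) * ∫ r in (τ - h)..τ, ‖g r‖ ^ 2) := by gcongr
      _ = _ := by field_simp; ring


variable {𝕜 V : Type*} [RCLike 𝕜] [NormedAddCommGroup V] [InnerProductSpace 𝕜 V]

theorem Antidual.continuous_re_apply :
    Continuous fun q : Antidual 𝕜 V × V => RCLike.re (q.1 q.2) := by
  refine RCLike.continuous_re.comp (continuous_iff_continuousAt.2 fun q₀ => ?_)
  have h1 : Tendsto (fun q : Antidual 𝕜 V × V => (q.1 - q₀.1) q.2) (𝓝 q₀) (𝓝 0) := by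
    refine squeeze_zero_norm (fun q => (q.1 - q₀.1).le_opNorm q.2) ?_
    have : Continuous fun q : Antidual 𝕜 V × V => ‖q.1 - q₀.1‖ * ‖q.2‖ := by fun_prop
    simpa using this.tendsto q₀
  have h2 : Tendsto (fun q : Antidual 𝕜 V × V => q₀.1 q.2) (𝓝 q₀) (𝓝 (q₀.1 q₀.2)) :=
    (q₀.1.continuous.comp continuous_snd).tendsto q₀
  simpa [ContinuousAt] using h1.add h2

theorem Antidual.abs_re_apply_le (g : Antidual 𝕜 V) (v : V) :
    |RCLike.re (g v)| ≤ 1 / 2 * ‖g‖ ^ 2 + 1 / 2 * ‖v‖ ^ 2 := by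
  have h1 := (RCLike.abs_re_le_norm (g v)).trans (g.le_opNorm v)
  nlinarith [sq_nonneg (‖g‖ - ‖v‖)]

theorem Antidual.integrable_re_apply {g : ℝ → Antidual 𝕜 V} {z : ℝ → V}
    (hg : AEStronglyMeasurable g volume) (hg2 : Integrable (fun x => ‖g x‖ ^ 2) volume)
    (hz : AEStronglyMeasurable z volume) (hz2 : Integrable (fun x => ‖z x‖ ^ 2) volume) :
    Integrable (fun x => RCLike.re (g x (z x))) volume := by
  refine ((hg2.const_mul (1 / 2)).add (hz2.const_mul (1 / 2))).mono'
    (continuous_re_apply.comp_aestronglyMeasurable (hg.prodMk hz)) ?_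
  exact Eventually.of_forall fun x => abs_re_apply_le _ _

/-- The one-sided form of the energy identity. The difference quotients `h⁻¹ ∫ g` converge to `g`
almost everywhere but need not be dominated; after subtracting half the difference quotient of
`K = ∫ ‖g‖²`, whose integral converges by `tendsto_integral_backward_quotient`, the pairing with `z`
is bounded above by `‖z‖² / 2`, and an upper bound is all that is needed. -/
theorem le_integral_of_quotient_le {ψ : ℝ → ℝ} (hψ : LocallyIntegrable ψ volume)
    {g : ℝ → Antidual 𝕜 V} {z : ℝ → V}
    (hg : Integrable g volume) (hg2 : Integrable (fun x => ‖g x‖ ^ 2) volume)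
    (hz : AEStronglyMeasurable z volume) (hz2 : Integrable (fun x => ‖z x‖ ^ 2) volume)
    {s t : ℝ} (hst : s ≤ t)
    (hs : HasDerivAt (fun x => ∫ r in (0 : ℝ)..x, ψ r) (ψ s) s)
    (ht : HasDerivAt (fun x => ∫ r in (0 : ℝ)..x, ψ r) (ψ t) t)
    {l : Filter ℝ} [l.NeBot] [l.IsCountablyGenerated] (hl : l ≤ 𝓝[≠] 0)
    (h : ∀ᶠ h in l, ∀ᵐ τ, τ ∈ Ioc s t → h⁻¹ * (ψ τ - ψ (τ - h)) ≤
      RCLike.re ((h⁻¹ • ∫ r in (τ - h)..τ, g r) (z τ))) :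
    ψ t - ψ s ≤ ∫ τ in s..t, RCLike.re (g τ (z τ)) := by
  have gi := hg.locallyIntegrable.intervalIntegrable
  have gi2 := hg2.locallyIntegrable.intervalIntegrable
  have ψi := hψ.intervalIntegrable
  set K : ℝ → ℝ := fun x => ∫ r in (0 : ℝ)..x, ‖g r‖ ^ 2 with hK
  set G : ℝ → Antidual 𝕜 V := fun x => ∫ r in (0 : ℝ)..x, g r with hG
  have Kc : Continuous K := intervalIntegral.continuous_primitive gi2 0
  have Gc : Continuous G := intervalIntegral.continuous_primitive gi 0
  have Gd : ∀ τ h : ℝ, ∫ r in (τ - h)..τ, g r = G τ - G (τ - h) := fun τ h =>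
    (intervalIntegral.integral_interval_sub_left (gi 0 τ) (gi 0 (τ - h))).symm
  have Kd : ∀ τ h : ℝ, ∫ r in (τ - h)..τ, ‖g r‖ ^ 2 = K τ - K (τ - h) := fun τ h =>
    (intervalIntegral.integral_interval_sub_left (gi2 0 τ) (gi2 0 (τ - h))).symm
  have Kder : ∀ x, HasDerivAt (fun x => ∫ r in (0 : ℝ)..x, K r) (K x) x := fun x =>
    intervalIntegral.integral_hasDerivAt_right (Kc.intervalIntegrable _ _)
      (Kc.stronglyMeasurableAtFilter _ _) Kc.continuousAt
  have Klim := (tendsto_integral_backward_quotient Kc.locallyIntegrable (Kder s)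
    (Kder t)).mono_left hl
  have gz := Antidual.integrable_re_apply hg.aestronglyMeasurable hg2 hz hz2
  set m : ℝ → ℝ := fun τ => RCLike.re (g τ (z τ)) - 1 / 2 * ‖g τ‖ ^ 2 with hm
  have mi : Integrable m volume := gz.sub (hg2.const_mul _)
  -- the maximum with the limit `m` makes the family bounded below as well
  set E : ℝ → ℝ → ℝ := fun h τ => max (RCLike.re ((h⁻¹ • (G τ - G (τ - h))) (z τ)) -
    1 / 2 * (h⁻¹ * (K τ - K (τ - h)))) (m τ) with hE
  have Em : ∀ h, AEStronglyMeasurable (E h) volume := by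
    intro h
    refine AEStronglyMeasurable.sup (AEStronglyMeasurable.sub ?_ ?_) mi.aestronglyMeasurable
    · refine Antidual.continuous_re_apply.comp_aestronglyMeasurable 
        (AEStronglyMeasurable.prodMk ?_ hz)
      exact Continuous.aestronglyMeasurable (by fun_prop)
    · exact Continuous.aestronglyMeasurable (by fun_prop)
  have Eb : ∀ h, h ≠ 0 → ∀ τ, ‖E h τ‖ ≤ |m τ| + 1 / 2 * ‖z τ‖ ^ 2 := by
    intro h hh τ
    have h1 := norm_sq_average_le hg.locallyIntegrable hg2.locallyIntegrable τ hh
    rw [Gd, Kd] at h1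
    have h2 := (abs_le.1 (Antidual.abs_re_apply_le (h⁻¹ • (G τ - G (τ - h))) (z τ))).2
    have h3 : 0 ≤ ‖z τ‖ ^ 2 := by positivity
    rw [Real.norm_eq_abs, abs_le]
    constructor
    · have := neg_abs_le (m τ)
      exact le_trans (by linarith) (le_max_right _ _)
    · refine max_le ?_ ?_
      · have := abs_nonneg (m τ)
        linarith
      · have := le_abs_self (m τ)
        linarith
  have bi : Integrable (fun τ => |m τ| + 1 / 2 * ‖z τ‖ ^ 2) volume := mi.abs.add (hz2.const_mul _)
  have Elim : Tendsto (fun h => ∫ τ in s..t, E h τ) l (𝓝 (∫ τ in s..t, m τ)) := by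
    refine intervalIntegral.tendsto_integral_filter_of_dominated_convergence
      (fun τ => |m τ| + 1 / 2 * ‖z τ‖ ^ 2) (Eventually.of_forall fun h => (Em h).restrict) ?_
      (bi.locallyIntegrable.intervalIntegrable _ _) ?_
    · filter_upwards [hl self_mem_nhdsWithin] with h hh
      exact Eventually.of_forall fun τ _ => Eb h hh τ
    · filter_upwards [LocallyIntegrable.ae_hasDerivAt_integral hg.locallyIntegrable,
        LocallyIntegrable.ae_hasDerivAt_integral hg2.locallyIntegrable] with τ h1 h2 _
      have l1 := (h1 0).tendsto_backward_quotient.mono_left hl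
      have l2 := (h2 0).tendsto_backward_quotient.mono_left hl
      have l3 := (Antidual.continuous_re_apply (𝕜 := 𝕜) (V := V)).continuousAt.tendsto.comp
        (l1.prodMk_nhds (tendsto_const_nhds (x := z τ)))
      have l4 := (l3.sub (l2.const_mul (1 / 2))).max (tendsto_const_nhds (x := m τ))
      simpa [hE, hm, Function.comp_def] using! l4
  have Ei : ∀ h, h ≠ 0 → Integrable (E h) volume := fun h hh =>
    bi.mono' (Em h) (Eventually.of_forall (Eb h hh))
  have L := tendsto_integral_backward_quotient hψ hs ht |>.mono_left hl
  have R := (Klim.const_mul (1 / 2)).add Elim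
  have Rval : 1 / 2 * (K t - K s) + ∫ τ in s..t, m τ = ∫ τ in s..t, RCLike.re (g τ (z τ)) := by
    rw [hm, intervalIntegral.integral_sub (gz.locallyIntegrable.intervalIntegrable _ _)
      ((gi2 _ _).const_mul _), intervalIntegral.integral_const_mul,
      ← intervalIntegral.integral_interval_sub_left (gi2 0 t) (gi2 0 s)]
    ring
  rw [Rval] at R
  refine le_of_tendsto_of_tendsto L R ?_
  filter_upwards [h, hl self_mem_nhdsWithin] with h hh h0
  have Kq : IntervalIntegrable (fun τ => h⁻¹ * (K τ - K (τ - h))) volume s t :=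
    Continuous.intervalIntegrable (by fun_prop) _ _
  rw [← intervalIntegral.integral_const_mul, ← intervalIntegral.integral_add (Kq.const_mul _)
    ((Ei h h0).locallyIntegrable.intervalIntegrable _ _)]
  rw [intervalIntegral.integral_of_le hst, intervalIntegral.integral_of_le hst]
  refine setIntegral_mono_on_ae (((ψi s t).sub
    (by simpa using (ψi (s - h) (t - h)).comp_sub_right h)).const_mul _).1
    ((Kq.const_mul _).add ((Ei h h0).locallyIntegrable.intervalIntegrable _ _)).1
    measurableSet_Ioc ?_
  filter_upwards [hh] with τ h1 h2
  have h3 := h1 h2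
  rw [Gd] at h3
  have h4 : _ ≤ E h τ := le_max_left _ _
  linarith

/-- **Energy identity.** If `ψ` satisfies the subgradient inequality with subgradient `z τ` at
almost every `τ` along the trajectory with derivative `g`, then `ψ` has the derivative `Re ⟨g, z⟩`
in integrated form. Positive and negative increments give the two inequalities. -/
theorem energy_identity {ψ : ℝ → ℝ} (hψ : LocallyIntegrable ψ volume)
    {g : ℝ → Antidual 𝕜 V} {z : ℝ → V}
    (hg : Integrable g volume) (hg2 : Integrable (fun x => ‖g x‖ ^ 2) volume)
    (hz : AEStronglyMeasurable z volume) (hz2 : Integrable (fun x => ‖z x‖ ^ 2) volume)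
    {T : ℝ} {S : Set ℝ} (hS : ∀ᵐ t, t ∈ Ioo 0 T → t ∈ S)
    (h : ∀ σ ∈ S, ∀ τ ∈ S, ψ τ - ψ σ ≤ RCLike.re ((∫ r in σ..τ, g r) (z τ)))
    {s t : ℝ} (hs0 : 0 < s) (hst : s ≤ t) (htT : t < T)
    (hs : HasDerivAt (fun x => ∫ r in (0 : ℝ)..x, ψ r) (ψ s) s)
    (ht : HasDerivAt (fun x => ∫ r in (0 : ℝ)..x, ψ r) (ψ t) t) :
    ψ t - ψ s = ∫ τ in s..t, RCLike.re (g τ (z τ)) := by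
  have hshift : ∀ h : ℝ, ∀ᵐ τ, τ - h ∈ Ioo 0 T → τ - h ∈ S := fun h =>
    (measurePreserving_sub_right volume h).quasiMeasurePreserving.ae hS
  have hmem : ∀ᶠ h : ℝ in 𝓝 0, ∀ τ ∈ Ioc s t, τ ∈ Ioo 0 T ∧ τ - h ∈ Ioo 0 T := by
    filter_upwards [Ioo_mem_nhds (show t - T < 0 by linarith) hs0] with h hh τ hτ
    simp only [mem_Ioo, mem_Ioc] at *
    refine ⟨⟨?_, ?_⟩, ?_, ?_⟩ <;> linarith
  have key : ∀ᶠ h : ℝ in 𝓝 0, ∀ᵐ τ, τ ∈ Ioc s t →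
      ψ τ - ψ (τ - h) ≤ RCLike.re ((∫ r in (τ - h)..τ, g r) (z τ)) := by
    filter_upwards [hmem] with k hk
    filter_upwards [hS, hshift k] with τ h1 h2 h3
    exact h _ (h2 (hk τ h3).2) _ (h1 (hk τ h3).1)
  apply le_antisymm
  · refine le_integral_of_quotient_le hψ hg hg2 hz hz2 hst hs ht
      (l := 𝓝[>] 0) (nhdsWithin_mono _ fun x hx => ne_of_gt hx) ?_
    filter_upwards [key.filter_mono nhdsWithin_le_nhds, self_mem_nhdsWithin] with k hk k0
    filter_upwards [hk] with τ h1 h2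
    rw [smul_apply, RCLike.smul_re]
    exact mul_le_mul_of_nonneg_left (h1 h2) (inv_nonneg.2 (le_of_lt k0))
  -- for negative increments the same estimate reads as one for `-ψ` and `-z`
  · have hs' : HasDerivAt (fun x => ∫ r in (0 : ℝ)..x, -ψ r) (-ψ s) s := by
      simpa using! hs.neg
    have ht' : HasDerivAt (fun x => ∫ r in (0 : ℝ)..x, -ψ r) (-ψ t) t := by
      simpa using! ht.neg
    have := le_integral_of_quotient_le (ψ := fun x => -ψ x) hψ.neg hg hg2 hz.neg
      (by simpa using hz2) hst hs' ht'
      (l := 𝓝[<] 0) (nhdsWithin_mono _ fun x hx => ne_of_lt hx) ?_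
    · simp only [Pi.neg_apply, map_neg, intervalIntegral.integral_neg] at this
      linarith
    filter_upwards [key.filter_mono nhdsWithin_le_nhds, self_mem_nhdsWithin] with k hk k0
    filter_upwards [hk] with τ h1 h2
    rw [smul_apply, RCLike.smul_re, Pi.neg_apply, map_neg, map_neg]
    have h4 := h1 h2
    have h5 : k⁻¹ < 0 := inv_lt_zero.2 k0
    nlinarith

end DifferenceQuotients

/-! ### Primitives and weak derivatives -/

section WeakDerivative

variable {E : Type*} [NormedAddCommGroup E] [NormedSpace ℝ E] [CompleteSpace E]

/-- The primitive of a test function with vanishing integral is a test function. -/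
theorem contDiff_primitive_test_function {T : ℝ} {η : ℝ → ℝ} (hη : ContDiff ℝ (⊤ : ℕ∞) η)
    (hc : HasCompactSupport η) (hs : tsupport η ⊆ Ioo 0 T) (h0 : ∫ t, η t = 0) :
    ContDiff ℝ (⊤ : ℕ∞) (fun t => ∫ r in (0 : ℝ)..t, η r) ∧
    HasCompactSupport (fun t => ∫ r in (0 : ℝ)..t, η r) ∧
    tsupport (fun t => ∫ r in (0 : ℝ)..t, η r) ⊆ Ioo 0 T := by
  have hd : ∀ t, HasDerivAt (fun t => ∫ r in (0 : ℝ)..t, η r) (η t) t := fun t =>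
    intervalIntegral.integral_hasDerivAt_right (hη.continuous.intervalIntegrable _ _)
      (hη.continuous.stronglyMeasurableAtFilter _ _) hη.continuous.continuousAt
  have hder : deriv (fun t => ∫ r in (0 : ℝ)..t, η r) = η := funext fun t => (hd t).deriv
  obtain ⟨a, b, ha, hb, hab⟩ : ∃ a b : ℝ, 0 < a ∧ b < T ∧ tsupport η ⊆ Icc a b := by
    rcases (tsupport η).eq_empty_or_nonempty with he | hne
    · exact ⟨1, T - 1, by simp, by simp, by simp [he]⟩
    · have hK : IsCompact (tsupport η) := hc
      refine ⟨sInf (tsupport η), sSup (tsupport η), (hs (hK.sInf_mem hne)).1,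
        (hs (hK.sSup_mem hne)).2, fun x hx => ⟨csInf_le hK.bddBelow hx, le_csSup hK.bddAbove hx⟩⟩
  have hz : ∀ t, t ∉ Icc a b → η t = 0 := fun t ht =>
    image_eq_zero_of_notMem_tsupport fun h => ht (hab h)
  have hsupp : tsupport (fun t => ∫ r in (0 : ℝ)..t, η r) ⊆ Icc a b := by
    refine closure_minimal ?_ isClosed_Icc
    intro t ht
    by_contra hn
    apply ht
    rcases lt_or_ge t a with h1 | h1
    · refine (intervalIntegral.integral_congr (g := fun _ => (0 : ℝ)) fun r hr => ?_).trans
        (by simp)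
      refine hz r fun hr' => ?_
      rcases mem_uIcc.1 hr with h | h <;> linarith [hr'.1, h.1, h.2]
    · have h2 : b < t := by
        by_contra h
        exact hn ⟨h1, not_lt.1 h⟩
      have h3 : Function.support η ⊆ Ioc 0 t := fun r hr => by
        have := hab (subset_tsupport _ hr)
        exact ⟨ha.trans_le this.1, this.2.trans h2.le⟩
      show ∫ r in (0 : ℝ)..t, η r = 0
      rw [intervalIntegral.integral_eq_integral_of_support_subset h3, h0]
  refine ⟨?_, isCompact_Icc.of_isClosed_subset (isClosed_tsupport _) hsupp,
    hsupp.trans fun x hx => ⟨ha.trans_le hx.1, hx.2.trans_lt hb⟩⟩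
  exact contDiff_infty_iff_deriv.2 ⟨fun t => (hd t).differentiableAt, by rwa [hder]⟩

/-- Integration by parts against a primitive, in the form of Fubini's theorem on a triangle. -/
theorem integral_primitive_smul {T : ℝ} {η : ℝ → ℝ} (hη : IntegrableOn η (Ioo 0 T) volume)
    {g : ℝ → E} (hg : IntegrableOn g (Ioo 0 T) volume) :
    ∫ t in Ioo 0 T, (∫ r in (0 : ℝ)..t, η r) • g t =
      ∫ r in Ioo 0 T, η r • ∫ t in r..T, g t := by
  set μ := volume.restrict (Ioo (0 : ℝ) T) with hμ
  have hint : Integrable (Function.uncurry fun t r : ℝ => (Iio t).indicator η r • g t)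
      (μ.prod μ) := by
    have h1 : Integrable (fun p : ℝ × ℝ => η p.2 • g p.1) (μ.prod μ) :=
      (Integrable.smul_prod (f := η) (g := g) hη hg).swap
    have h2 : MeasurableSet {p : ℝ × ℝ | p.2 < p.1} :=
      measurableSet_lt measurable_snd measurable_fst
    refine (h1.indicator h2).congr (Filter.Eventually.of_forall fun p => ?_)
    by_cases hp : p.2 < p.1 <;> simp [Function.uncurry, indicator, hp]
  have hswap := integral_integral_swap hint
  have e1 : ∀ t ∈ Ioo 0 T,
      ∫ r, (Iio t).indicator η r • g t ∂μ = (∫ r in (0 : ℝ)..t, η r) • g t := by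
    intro t ht
    rw [integral_smul_const, integral_indicator measurableSet_Iio, hμ,
      Measure.restrict_restrict measurableSet_Iio, intervalIntegral.integral_of_le ht.1.le,
      integral_Ioc_eq_integral_Ioo]
    congr 3
    ext x; simp only [mem_inter_iff, mem_Iio, mem_Ioo] at *; constructor
    · rintro ⟨h1, h2, h3⟩; exact ⟨h2, h1⟩
    · rintro ⟨h1, h2⟩; exact ⟨h2, h1, h2.trans ht.2⟩
  have e2 : ∀ r ∈ Ioo 0 T, ∫ t, (Iio t).indicator η r • g t ∂μ = η r • ∫ t in r..T, g t := by
    intro r hr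
    have : ∀ t, (Iio t).indicator η r • g t = η r • (Ioi r).indicator g t := by
      intro t
      by_cases h : r < t <;> simp [indicator, h]
    simp_rw [this]
    rw [integral_smul, integral_indicator measurableSet_Ioi, hμ,
      Measure.restrict_restrict measurableSet_Ioi, intervalIntegral.integral_of_le hr.2.le,
      integral_Ioc_eq_integral_Ioo]
    congr 3
    ext x; simp only [mem_inter_iff, mem_Ioi, mem_Ioo] at *; constructor
    · rintro ⟨h1, h2, h3⟩; exact ⟨h1, h3⟩
    · rintro ⟨h1, h2⟩; exact ⟨h1, hr.1.trans h1, h2⟩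
  rw [← setIntegral_congr_fun measurableSet_Ioo e1, ← setIntegral_congr_fun measurableSet_Ioo e2]
  exact hswap

/-- A function with an integrable weak derivative is, up to a constant, a primitive of it
(du Bois-Reymond's lemma). -/
theorem HasWeakDeriv.exists_ae_eq_add_integral {T : ℝ} (hT : 0 < T) {y g : ℝ → E}
    (hy : IntegrableOn y (Ioo 0 T) volume) (hg : IntegrableOn g (Ioo 0 T) volume)
    (h : HasWeakDeriv T y g) :
    ∃ c : E, ∀ᵐ t, t ∈ Ioo 0 T → y t = c + ∫ r in (0 : ℝ)..t, g r := by
  have hgi : ∀ a ∈ Icc 0 T, ∀ b ∈ Icc 0 T, IntervalIntegrable g volume a b := by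
    intro a ha b hb
    have : IntegrableOn g (Icc 0 T) volume :=
      (integrableOn_Icc_iff_integrableOn_Ioo (by simp) (by simp)).2 hg
    exact intervalIntegrable_iff.2 (this.mono_set fun x hx => by
      rcases mem_uIoc.1 hx with h | h
      · exact ⟨ha.1.trans h.1.le, h.2.trans hb.2⟩
      · exact ⟨hb.1.trans h.1.le, h.2.trans ha.2⟩)
  have hT0 : (0 : ℝ) ∈ Icc 0 T := ⟨le_rfl, hT.le⟩
  have hTT : T ∈ Icc 0 T := ⟨hT.le, le_rfl⟩
  set q : ℝ → E := fun t => y t + ∫ r in t..T, g r with hq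
  have hgc : ContinuousOn (fun t => ∫ r in t..T, g r) (Icc 0 T) := by
    have := intervalIntegral.continuousOn_primitive_interval
      (f := g) (μ := volume) (a := 0) (b := T) (by
        rw [uIcc_of_le hT.le]
        exact (integrableOn_Icc_iff_integrableOn_Ioo (by simp) (by simp)).2 hg)
    rw [uIcc_of_le hT.le] at this
    refine ((continuousOn_const (c := ∫ r in (0 : ℝ)..T, g r)).sub this).congr fun t ht => ?_
    exact (intervalIntegral.integral_interval_sub_left (hgi 0 hT0 T hTT) (hgi 0 hT0 t ht)).symm
  have hqi : IntegrableOn q (Ioo 0 T) volume :=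
    hy.add ((hgc.integrableOn_compact isCompact_Icc).mono_set Ioo_subset_Icc_self)
  have hmul : ∀ {η : ℝ → ℝ} {q : ℝ → E}, Continuous η → HasCompactSupport η →
      IntegrableOn q (Ioo 0 T) volume →
      Integrable (fun t => η t • q t) (volume.restrict (Ioo 0 T)) := by
    intro η q hη hc hq
    obtain ⟨C, hC⟩ := hc.exists_bound_of_continuous hη
    exact hq.bdd_smul C hη.aestronglyMeasurable (Filter.Eventually.of_forall hC)
  -- testing with the primitive of a mean-zero `η` shows that `q` is orthogonal to `η`
  have orth : ∀ η : ℝ → ℝ, ContDiff ℝ (⊤ : ℕ∞) η → HasCompactSupport η → tsupport η ⊆ Ioo 0 T →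
      ∫ t, η t = 0 → ∫ t in Ioo 0 T, η t • q t = 0 := by
    intro η hη hc hs h0
    obtain ⟨p1, p2, p3⟩ := contDiff_primitive_test_function hη hc hs h0
    have e := h _ p1 p2 p3
    have hder : deriv (fun t => ∫ r in (0 : ℝ)..t, η r) = η := funext fun t =>
      (hη.continuous.deriv_integral η 0 t)
    rw [hder, integral_primitive_smul
      (hη.continuous.integrable_of_hasCompactSupport hc).integrableOn hg] at e
    simp only [hq, smul_add]
    rw [integral_add (hmul hη.continuous hc hy) (hmul hη.continuous hc
      ((hgc.integrableOn_compact isCompact_Icc).mono_set Ioo_subset_Icc_self)), ← e, add_neg_cancel]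
  let b : ContDiffBump (T / 2) := ⟨T / 8, T / 4, by positivity, by linarith⟩
  set η₀ : ℝ → ℝ := b.normed volume with hη₀
  have b1 : ContDiff ℝ (⊤ : ℕ∞) η₀ := b.contDiff_normed
  have b2 : HasCompactSupport η₀ := b.hasCompactSupport_normed
  have b3 : tsupport η₀ ⊆ Ioo 0 T := by
    rw [hη₀, b.tsupport_normed_eq, Real.closedBall_eq_Icc]
    intro x hx
    have h1 : b.rOut = T / 4 := rfl
    rw [h1] at hx
    exact ⟨by linarith [hx.1], by linarith [hx.2]⟩
  have b4 : ∫ t, η₀ t = 1 := b.integral_normed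
  -- subtracting a multiple of `η₀` makes an arbitrary test function mean-zero
  set c : E := ∫ t in Ioo 0 T, η₀ t • q t with hc
  have main := isOpen_Ioo.ae_eq_zero_of_integral_contDiff_smul_eq_zero (U := Ioo 0 T)
    (f := (Ioo 0 T).indicator fun t => q t - c) (μ := volume) ?_ ?_
  · refine ⟨c - ∫ r in (0 : ℝ)..T, g r, ?_⟩
    filter_upwards [main] with t ht htm
    have := ht htm
    rw [indicator_of_mem htm, sub_eq_zero] at this
    simp only [← this, hq]
    rw [← intervalIntegral.integral_interval_sub_left (hgi 0 hT0 T hTT)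
      (hgi 0 hT0 t ⟨htm.1.le, htm.2.le⟩)]
    abel
  · have : IntegrableOn (fun t => q t - c) (Ioo 0 T) volume := hqi.sub (by simp)
    exact (this.integrable_indicator measurableSet_Ioo).locallyIntegrable.locallyIntegrableOn _
  · intro η e1 e2 e3
    have hi : Integrable η volume := e1.continuous.integrable_of_hasCompactSupport e2
    have hi0 : Integrable η₀ volume := b1.continuous.integrable_of_hasCompactSupport b2
    have s := orth (fun t => η t - (∫ r, η r) * η₀ t) (e1.sub (contDiff_const.mul b1))
      (e2.sub b2.mul_left) ?_ ?_
    · have : (fun t => η t • (Ioo 0 T).indicator (fun t => q t - c) t) =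
          (Ioo 0 T).indicator (fun t => η t • (q t - c)) := by
        ext t; by_cases ht : t ∈ Ioo 0 T <;> simp [ht]
      rw [this, integral_indicator measurableSet_Ioo]
      simp only [sub_smul, smul_sub, mul_smul] at s ⊢
      rw [integral_sub (hmul e1.continuous e2 hqi)
        ((hmul b1.continuous b2 hqi).fun_smul _), integral_smul, ← hc] at s
      rw [integral_sub (hmul e1.continuous e2 hqi) (hi.integrableOn.smul_const c),
        integral_smul_const, setIntegral_eq_integral_of_forall_compl_eq_zero (f := η), s]
      intro t ht
      exact image_eq_zero_of_notMem_tsupport fun h => ht (e3 h)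
    · refine (tsupport_sub _ _).trans (union_subset e3 ?_)
      exact (closure_mono (Function.support_mul_subset_right _ _)).trans b3
    · rw [integral_sub hi (hi0.const_mul _), integral_const_mul, b4]
      ring

end WeakDerivative

/-! ### The continuous representative -/

section ContinuousRepresentative

open Filter Topology

variable {𝕜 V H : Type*} [RCLike 𝕜]
  [NormedAddCommGroup V] [InnerProductSpace 𝕜 V]
  [NormedAddCommGroup H] [InnerProductSpace 𝕜 H]

theorem norm_sq_sub_norm_sq_le (x y : H) :
    1 / 2 * ‖x‖ ^ 2 - 1 / 2 * ‖y‖ ^ 2 ≤ RCLike.re (inner 𝕜 x (x - y)) := by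
  have h := norm_sub_sq (𝕜 := 𝕜) x y
  rw [inner_sub_right, map_sub, inner_self_eq_norm_sq]
  nlinarith [sq_nonneg ‖x - y‖]

theorem half_norm_sub_sq (x y : H) :
    1 / 2 * ‖x - y‖ ^ 2 =
      1 / 2 * ‖x‖ ^ 2 - 1 / 2 * ‖y‖ ^ 2 - RCLike.re (inner 𝕜 y (x - y)) := by
  have h := norm_sub_sq (𝕜 := 𝕜) x y
  rw [inner_sub_right, map_sub, inner_self_eq_norm_sq, inner_re_symm (𝕜 := 𝕜) y x]
  linarith

theorem abs_re_integral_apply_le {g : ℝ → Antidual 𝕜 V}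
    (hg : Integrable g volume) (hg2 : Integrable (fun x => ‖g x‖ ^ 2) volume)
    {a b : ℝ} (hab : a < b) (v : V) :
    |RCLike.re ((∫ x in a..b, g x) v)| ≤
      1 / 2 * (∫ x in a..b, ‖g x‖ ^ 2) + 1 / 2 * ((b - a) * ‖v‖ ^ 2) := by
  have hpos : 0 < b - a := sub_pos.2 hab
  have h1 := Antidual.abs_re_apply_le ((b - a)⁻¹ • ∫ x in a..b, g x) v
  have h2 := norm_sq_average_le hg.locallyIntegrable hg2.locallyIntegrable b hpos.ne'
  rw [sub_sub_cancel] at h2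
  rw [smul_apply, RCLike.smul_re, abs_mul, abs_of_pos (inv_pos.2 hpos)] at h1
  have h3 := mul_le_mul_of_nonneg_left (h1.trans (add_le_add_left
    (mul_le_mul_of_nonneg_left h2 (by norm_num : (0 : ℝ) ≤ 1 / 2)) _)) hpos.le
  rw [mul_inv_cancel_left₀ hpos.ne'] at h3
  refine h3.trans (le_of_eq ?_)
  field_simp

theorem abs_integral_re_apply_le {g : ℝ → Antidual 𝕜 V} {z : ℝ → V}
    (hg2 : Integrable (fun x => ‖g x‖ ^ 2) volume)
    (hz2 : Integrable (fun x => ‖z x‖ ^ 2) volume) {a b : ℝ} (hab : a ≤ b) :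
    |∫ x in a..b, RCLike.re (g x (z x))| ≤
      1 / 2 * (∫ x in a..b, ‖g x‖ ^ 2) + 1 / 2 * ∫ x in a..b, ‖z x‖ ^ 2 := by
  have i1 := (hg2.locallyIntegrable.intervalIntegrable a b).const_mul (1 / 2)
  have i2 := (hz2.locallyIntegrable.intervalIntegrable a b).const_mul (1 / 2)
  rw [← intervalIntegral.integral_const_mul, ← intervalIntegral.integral_const_mul,
    ← intervalIntegral.integral_add i1 i2]
  rw [← Real.norm_eq_abs]
  exact intervalIntegral.norm_integral_le_of_norm_le hab
    (Eventually.of_forall fun x _ => Antidual.abs_re_apply_le _ _) (i1.add i2)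

theorem exists_mem_mul_le_integral {f : ℝ → ℝ} (hf : Integrable f volume) {T : ℝ}
    {S : Set ℝ} (hS : ∀ᵐ t, t ∈ Ioo 0 T → t ∈ S) {s t : ℝ} (hs : 0 ≤ s) (hst : s < t)
    (ht : t ≤ T) : ∃ r ∈ S, s < r ∧ r < t ∧ (t - s) * f r ≤ ∫ x in s..t, f x := by
  have hN : (volume.restrict (Ioo s t)) {x | ¬ (x ∈ Ioo s t ∧ x ∈ S)} = 0 := by
    rw [← ae_iff]
    filter_upwards [ae_restrict_mem measurableSet_Ioo, ae_restrict_of_ae hS] with x hx h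
    exact ⟨hx, h ⟨hs.trans_lt hx.1, hx.2.trans_le ht⟩⟩
  obtain ⟨r, hr, hle⟩ := exists_notMem_null_le_average
    (μ := volume.restrict (Ioo s t)) (by simp [hst]) hf.integrableOn hN
  simp only [mem_ofPred_eq, not_not] at hr
  refine ⟨r, hr.2, hr.1.1, hr.1.2, ?_⟩
  have hpos : 0 < t - s := sub_pos.2 hst
  rw [setAverage_eq, Real.volume_real_Ioo_of_le hst.le, ← integral_Ioc_eq_integral_Ioo,
    ← intervalIntegral.integral_of_le hst.le, smul_eq_mul] at hle
  have := mul_le_mul_of_nonneg_left hle hpos.le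
  rwa [mul_inv_cancel_left₀ hpos.ne'] at this

theorem Icc_subset_closure_of_ae {T : ℝ} (hT : 0 < T) {S : Set ℝ}
    (hS : ∀ᵐ t, t ∈ Ioo 0 T → t ∈ S) : Icc 0 T ⊆ closure S := by
  have h1 : Dense {t : ℝ | t ∈ Ioo 0 T → t ∈ S} := Measure.dense_of_ae hS
  have h2 := h1.open_subset_closure_inter (isOpen_Ioo (a := 0) (b := T))
  have h3 : Ioo 0 T ⊆ closure S := h2.trans (closure_mono fun x hx => hx.2 hx.1)
  rw [← closure_Ioo hT.ne]
  exact closure_minimal h3 isClosed_closure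

/-- A function on a dense part of `[0,T]` with values in a complete space, whose increments are
controlled by those of a continuous function, extends continuously to `[0,T]`. -/
theorem exists_continuousOn_extension {T : ℝ} (hT : 0 < T) [CompleteSpace H] {S : Set ℝ}
    (hS : ∀ᵐ t, t ∈ Ioo 0 T → t ∈ S) {x : ℝ → H} {L : ℝ → ℝ} (hL : Continuous L)
    (h : ∀ s ∈ S, ∀ t ∈ S, ‖x t - x s‖ ^ 2 ≤ |L t - L s|) :
    ∃ w : ℝ → H, ContinuousOn w (Icc 0 T) ∧ ∀ t ∈ S ∩ Icc 0 T, w t = x t := by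
  have hcl := Icc_subset_closure_of_ae hT hS
  have hlim : ∀ t ∈ Icc 0 T, ∃ y, Tendsto x (𝓝[S] t) (𝓝 y) := by
    intro t ht
    have hne : (𝓝[S] t).NeBot := mem_closure_iff_nhdsWithin_neBot.1 (hcl ht)
    refine CompleteSpace.complete (Metric.cauchy_iff.2 ⟨inferInstance, fun ε hε => ?_⟩)
    have h1 : Metric.ball (L t) (ε ^ 2 / 2) ∈ 𝓝 (L t) := Metric.ball_mem_nhds _ (by positivity)
    have h2 : L ⁻¹' Metric.ball (L t) (ε ^ 2 / 2) ∩ S ∈ 𝓝[S] t :=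
      inter_mem (nhdsWithin_le_nhds (hL.continuousAt h1)) self_mem_nhdsWithin
    refine ⟨x '' _, image_mem_map h2, ?_⟩
    rintro _ ⟨a, ⟨ha, haS⟩, rfl⟩ _ ⟨b, ⟨hb, hbS⟩, rfl⟩
    have h3 := h b hbS a haS
    have h4 : dist (L a) (L b) < ε ^ 2 := by
      have := dist_triangle_right (L a) (L b) (L t)
      rw [mem_preimage, Metric.mem_ball] at ha hb
      linarith
    rw [Real.dist_eq] at h4
    rw [dist_eq_norm]
    exact lt_of_pow_lt_pow_left₀ 2 hε.le (h3.trans_lt h4)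
  refine ⟨extendFrom S x, continuousOn_extendFrom hcl hlim, fun t ht => ?_⟩
  obtain ⟨y, hy⟩ := hlim t ht.2
  rw [extendFrom_eq (hcl ht.2) hy]
  have : y ∈ closure {x t} := by
    -- at points of `S` the limit within `S` includes the point itself
    have h5 : (pure t : Filter ℝ) ≤ 𝓝[S] t := pure_le_nhdsWithin ht.1
    have h6 := hy.mono_left h5
    rw [tendsto_pure_left] at h6
    refine mem_closure_iff_nhds.2 fun s hs => ⟨x t, h6 s hs, rfl⟩
  simpa using this

/-- **Lions' lemma**: a function in `H¹(0,T;V') ∩ L²(0,T;V)` has a representative in `C([0,T];H)`.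
For almost all `s < t`, the energy identity on `(s,r)` and `(r,t)` estimates `u t - u r` and
`u s - u r` in `H`, with a remainder `(t - s) ‖u r‖²`. For `r` at which `‖u r‖²` does not exceed its
mean over `(s,t)`, the remainder is at most `∫ ‖u‖²`, so that `u` is uniformly continuous on a
conull set. -/
theorem exists_continuous_representative [CompleteSpace H] (j : V →L[𝕜] H) {T : ℝ} (hT : 0 < T)
    {u : ℝ → V} (hu : AEStronglyMeasurable u volume)
    (hu2 : Integrable (fun x => ‖u x‖ ^ 2) volume)
    {g : ℝ → Antidual 𝕜 V} (hg : Integrable g volume)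
    (hg2 : Integrable (fun x => ‖g x‖ ^ 2) volume)
    {S : Set ℝ} (hS : ∀ᵐ t, t ∈ Ioo 0 T → t ∈ S)
    (h : ∀ σ ∈ S, ∀ τ ∈ S, toAntidual j (j (u τ) - j (u σ)) = ∫ r in σ..τ, g r) :
    ∃ w : ℝ → H, ContinuousOn w (Icc 0 T) ∧ ∀ᵐ t, t ∈ Ioo 0 T → w t = j (u t) := by
  set ψ : ℝ → ℝ := fun t => 1 / 2 * ‖j (u t)‖ ^ 2 with hψ
  have ψi : Integrable ψ volume := by
    refine Integrable.const_mul ?_ _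
    refine (hu2.const_mul (‖j‖ ^ 2)).mono'
      ((j.continuous.comp_aestronglyMeasurable hu).norm.pow 2) (Eventually.of_forall fun x => ?_)
    rw [Real.norm_of_nonneg (by positivity), ← mul_pow]
    exact pow_le_pow_left₀ (norm_nonneg _) (j.le_opNorm _) 2
  set S' : Set ℝ := {t | t ∈ S ∧ t ∈ Ioo 0 T ∧
    HasDerivAt (fun x => ∫ r in (0 : ℝ)..x, ψ r) (ψ t) t} with hS'
  have hS'ae : ∀ᵐ t, t ∈ Ioo 0 T → t ∈ S' := by
    filter_upwards [hS, LocallyIntegrable.ae_hasDerivAt_integral ψi.locallyIntegrable]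
      with t h1 h2 h3 using ⟨h1 h3, h3, h2 0⟩
  have energy : ∀ s ∈ S', ∀ t ∈ S', s ≤ t →
      ψ t - ψ s = ∫ τ in s..t, RCLike.re (g τ (u τ)) := by
    intro s hs t ht hst
    refine energy_identity ψi.locallyIntegrable hg hg2 hu hu2 hS (fun σ hσ τ hτ => ?_)
      hs.2.1.1 hst ht.2.1.2 hs.2.2 ht.2.2
    rw [← h σ hσ τ hτ, toAntidual_apply]
    exact norm_sq_sub_norm_sq_le _ _
  have gi2 := hg2.locallyIntegrable.intervalIntegrable
  have ui2 := hu2.locallyIntegrable.intervalIntegrable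
  have mono : ∀ s ∈ S', ∀ t ∈ S', s < t → ‖j (u t) - j (u s)‖ ^ 2 ≤
      4 * ((∫ x in s..t, ‖g x‖ ^ 2) + ∫ x in s..t, ‖u x‖ ^ 2) := by
    intro s hs t ht hst
    obtain ⟨r, hr, hsr, hrt, hle⟩ :=
      exists_mem_mul_le_integral hu2 hS'ae hs.2.1.1.le hst ht.2.1.2.le
    have e1 := half_norm_sub_sq (𝕜 := 𝕜) (j (u t)) (j (u r))
    have e2 := half_norm_sub_sq (𝕜 := 𝕜) (j (u s)) (j (u r))
    have e3 := energy r hr t ht hrt.le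
    have e4 := energy s hs r hr hsr.le
    have e5 := abs_le.1 (abs_integral_re_apply_le hg2 hu2 hrt.le)
    have e6 := abs_le.1 (abs_integral_re_apply_le hg2 hu2 hsr.le)
    have e7 := abs_le.1 (abs_re_integral_apply_le hg hg2 hrt (u r))
    have e8 := abs_le.1 (abs_re_integral_apply_le hg hg2 hsr (u r))
    rw [← h r hr.1 t ht.1, toAntidual_apply] at e7
    rw [← h s hs.1 r hr.1, toAntidual_apply, ← neg_sub (j (u s)) (j (u r)),
      inner_neg_right, map_neg] at e8
    have a1 := intervalIntegral.integral_add_adjacent_intervals (gi2 s r) (gi2 r t)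
    have a2 := intervalIntegral.integral_add_adjacent_intervals (ui2 s r) (ui2 r t)
    have n1 : ‖j (u t) - j (u s)‖ ≤ ‖j (u t) - j (u r)‖ + ‖j (u s) - j (u r)‖ := by
      have := norm_sub_le (j (u t) - j (u r)) (j (u s) - j (u r))
      rwa [sub_sub_sub_cancel_right] at this
    have n2 : ‖j (u t) - j (u s)‖ ^ 2 ≤
        2 * (‖j (u t) - j (u r)‖ ^ 2 + ‖j (u s) - j (u r)‖ ^ 2) := by
      nlinarith [norm_nonneg (j (u t) - j (u s)),
        sq_nonneg (‖j (u t) - j (u r)‖ - ‖j (u s) - j (u r)‖)]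
    simp only [hψ] at e3 e4
    nlinarith
  have Li : Integrable (fun x => 4 * (‖g x‖ ^ 2 + ‖u x‖ ^ 2)) volume :=
    (hg2.add hu2).const_mul 4
  have Lii := Li.locallyIntegrable.intervalIntegrable
  obtain ⟨w, hw, hwx⟩ := exists_continuousOn_extension hT hS'ae (x := fun t => j (u t))
    (L := fun t => ∫ x in (0 : ℝ)..t, 4 * (‖g x‖ ^ 2 + ‖u x‖ ^ 2))
    (intervalIntegral.continuous_primitive Lii 0) (by
      have key : ∀ s ∈ S', ∀ t ∈ S', s < t → ‖j (u t) - j (u s)‖ ^ 2 ≤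
          |(∫ x in (0 : ℝ)..t, 4 * (‖g x‖ ^ 2 + ‖u x‖ ^ 2)) -
            ∫ x in (0 : ℝ)..s, 4 * (‖g x‖ ^ 2 + ‖u x‖ ^ 2)| := by
        intro s hs t ht hst
        refine (mono s hs t ht hst).trans (le_trans (le_of_eq ?_) (le_abs_self _))
        rw [intervalIntegral.integral_interval_sub_left (Lii _ _) (Lii _ _),
          intervalIntegral.integral_const_mul, intervalIntegral.integral_add (gi2 _ _) (ui2 _ _)]
      intro s hs t ht
      rcases lt_trichotomy s t with hst | rfl | hst
      · exact key s hs t ht hst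
      · simp
      · rw [norm_sub_rev, abs_sub_comm]
        exact key t ht s hs hst)
  refine ⟨w, hw, ?_⟩
  filter_upwards [hS'ae] with t h1 h2 using hwx t ⟨h1 h2, h2.1.le, h2.2.le⟩

end ContinuousRepresentative

/-! ### The projection onto a convex set -/

section Projection

variable {𝕜 H : Type*} [RCLike 𝕜] [NormedAddCommGroup H] [InnerProductSpace 𝕜 H]

theorem IsProjPoint.norm_sub_le {C : Set H} {x y p q : H} (hp : IsProjPoint 𝕜 C x p)
    (hq : IsProjPoint 𝕜 C y q) : ‖p - q‖ ≤ ‖x - y‖ := by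
  have h1 := hp.2 q hq.1
  have h2 := hq.2 p hp.1
  have e : inner 𝕜 (p - q) (p - q) = inner 𝕜 (x - y) (p - q) +
      inner 𝕜 (x - p) (q - p) + inner 𝕜 (y - q) (p - q) := by
    rw [← neg_sub p q, inner_neg_right, ← sub_eq_add_neg, ← inner_sub_left, ← inner_add_left]
    congr 1
    abel
  have e2 := congrArg RCLike.re e
  rw [inner_self_eq_norm_sq, map_add, map_add] at e2
  have h3 := (RCLike.re_le_norm (inner 𝕜 (x - y) (p - q))).trans (norm_inner_le_norm _ _)
  by_contra hlt
  rw [not_le] at hlt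
  nlinarith [norm_nonneg (x - y)]

/-- Half the squared distance to `C` is convex, with gradient `x - p` at `x`. -/
theorem IsProjPoint.half_sq_dist_sub_le {C : Set H} {x y p q : H} (hp : IsProjPoint 𝕜 C x p)
    (hq : IsProjPoint 𝕜 C y q) :
    1 / 2 * ‖x - p‖ ^ 2 - 1 / 2 * ‖y - q‖ ^ 2 ≤ RCLike.re (inner 𝕜 (x - p) (x - y)) := by
  have h1 := hp.2 q hq.1
  have h2 := norm_sq_sub_norm_sq_le (𝕜 := 𝕜) (x - p) (y - q)
  have e : inner 𝕜 (x - p) (x - y) =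
      inner 𝕜 (x - p) (x - p - (y - q)) - inner 𝕜 (x - p) (q - p) := by
    rw [← inner_sub_right]
    congr 1
    abel
  rw [e, map_sub]
  linarith

end Projection

/-! ### Weak convergence and the invariance criterion -/

section WeakConvergence

open Filter Topology

variable {𝕜 V H : Type*} [RCLike 𝕜]
  [NormedAddCommGroup V] [InnerProductSpace 𝕜 V] [CompleteSpace V]
  [NormedAddCommGroup H] [InnerProductSpace 𝕜 H] [CompleteSpace H]

/-- A bounded sequence in `V` that converges in `H` converges weakly in `V`, since the functionals
coming from `H` are dense. -/
theorem tendsto_inner_of_tendsto_image {j : V →L[𝕜] H} (hj : Function.Injective j) {x : ℕ → V}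
    {x₀ : V} {R : ℝ} (hR : ∀ n, ‖x n‖ ≤ R) (hx : Tendsto (fun n => j (x n)) atTop (𝓝 (j x₀)))
    (y : V) : Tendsto (fun n => inner 𝕜 y (x n)) atTop (𝓝 (inner 𝕜 y x₀)) := by
  have hR0 : 0 ≤ R := (norm_nonneg _).trans (hR 0)
  have hy : y ∈ closure (range (ContinuousLinearMap.adjoint j)) := by
    have h1 := j.orthogonal_ker
    have h2 : j.ker = ⊥ := LinearMap.ker_eq_bot.2 hj
    rw [h2, Submodule.bot_orthogonal_eq_top] at h1
    have h3 : y ∈ (ContinuousLinearMap.adjoint j).range.topologicalClosure := h1 ▸ trivial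
    exact h3
  rw [Metric.tendsto_atTop]
  intro ε hε
  set D := R + ‖x₀‖ + 1 with hD
  have hD0 : 0 < D := by positivity
  obtain ⟨_, ⟨h, rfl⟩, hh⟩ := Metric.mem_closure_iff.1 hy (ε / 2 / D) (by positivity)
  have hlim : Tendsto (fun n => inner 𝕜 h (j (x n))) atTop (𝓝 (inner 𝕜 h (j x₀))) :=
    (tendsto_const_nhds (x := h)).inner hx
  obtain ⟨N, hN⟩ := Metric.tendsto_atTop.1 hlim (ε / 2) (by positivity)
  refine ⟨N, fun n hn => ?_⟩
  have h1 := hN n hn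
  rw [dist_eq_norm, ← inner_sub_right] at h1 ⊢
  have e : inner 𝕜 y (x n - x₀) = inner 𝕜 (y - ContinuousLinearMap.adjoint j h) (x n - x₀) +
      inner 𝕜 h (j (x n) - j x₀) := by
    rw [inner_sub_left, ContinuousLinearMap.adjoint_inner_left, map_sub, sub_add_cancel]
  rw [dist_eq_norm] at hh
  have h2 : ‖x n - x₀‖ ≤ D := (norm_sub_le _ _).trans (by linarith [hR n])
  have h3 := norm_inner_le_norm (𝕜 := 𝕜) (y - ContinuousLinearMap.adjoint j h) (x n - x₀)
  have h4 : ‖y - ContinuousLinearMap.adjoint j h‖ * ‖x n - x₀‖ ≤ ε / 2 / D * D :=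
    mul_le_mul hh.le h2 (norm_nonneg _) (by positivity)
  rw [div_mul_cancel₀ _ hD0.ne'] at h4
  rw [e]
  exact (norm_add_le _ _).trans_lt (by linarith)

theorem tendsto_linear_of_tendsto_image {j : V →L[𝕜] H} (hj : Function.Injective j) {x : ℕ → V}
    {x₀ : V} {R : ℝ} (hR : ∀ n, ‖x n‖ ≤ R) (hx : Tendsto (fun n => j (x n)) atTop (𝓝 (j x₀)))
    (l : V →L[𝕜] 𝕜) : Tendsto (fun n => l (x n)) atTop (𝓝 (l x₀)) := by
  simpa using tendsto_inner_of_tendsto_image hj hR hx ((InnerProductSpace.toDual 𝕜 V).symm l)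

theorem tendsto_antilinear_of_tendsto_image {j : V →L[𝕜] H} (hj : Function.Injective j)
    {x : ℕ → V} {x₀ : V} {R : ℝ} (hR : ∀ n, ‖x n‖ ≤ R)
    (hx : Tendsto (fun n => j (x n)) atTop (𝓝 (j x₀)))
    (g : Antidual 𝕜 V) : Tendsto (fun n => g (x n)) atTop (𝓝 (g x₀)) := by
  let l : V →L[𝕜] 𝕜 := ((starL 𝕜 : 𝕜 ≃L⋆[𝕜] 𝕜) : 𝕜 →L⋆[𝕜] 𝕜).comp g
  have h := tendsto_linear_of_tendsto_image hj hR hx l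
  have := (continuous_star.tendsto _).comp h
  simpa [l, Function.comp_def] using this

omit [CompleteSpace V] [CompleteSpace H] in
/-- A point `p` that satisfies the invariance criterion for `v` is bounded in `V` in terms of `v`,
`g` and its norm in `H`, by quasi-coercivity and Young's inequality. -/
theorem norm_sq_le_of_criterion {j : V →L[𝕜] H} {b : V →L[𝕜] Antidual 𝕜 V} {g : Antidual 𝕜 V}
    {M ω α : ℝ} (hα : 0 < α) (hM : ∀ u v, ‖b u v‖ ≤ M * ‖u‖ * ‖v‖)
    (hc : ∀ u, α * ‖u‖ ^ 2 ≤ RCLike.re (b u u) + ω * ‖j u‖ ^ 2) {v p : V}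
    (h : RCLike.re (g (v - p)) ≤ RCLike.re (b p (v - p))) :
    α / 2 * ‖p‖ ^ 2 ≤ (M ^ 2 / α + 1 / 2) * ‖v‖ ^ 2 + (1 / α + 1 / 2) * ‖g‖ ^ 2 +
      ω * ‖j p‖ ^ 2 := by
  have h1 := (RCLike.re_le_norm (b p v)).trans (hM p v)
  have h2 := (abs_le.1 ((RCLike.abs_re_le_norm (g v)).trans (g.le_opNorm v))).1
  have h3 := (RCLike.re_le_norm (g p)).trans (g.le_opNorm p)
  have h4 := hc p
  rw [map_sub, map_sub, map_sub, map_sub] at h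
  have h5 : M * ‖p‖ * ‖v‖ ≤ α / 4 * ‖p‖ ^ 2 + M ^ 2 / α * ‖v‖ ^ 2 := by
    have : α / 4 * ‖p‖ ^ 2 + M ^ 2 / α * ‖v‖ ^ 2 - M * ‖p‖ * ‖v‖ =
        (α * ‖p‖ / 2 - M * ‖v‖) ^ 2 / α := by field_simp; ring
    have h6 : 0 ≤ (α * ‖p‖ / 2 - M * ‖v‖) ^ 2 / α := by positivity
    linarith
  have h6 : ‖g‖ * ‖p‖ ≤ α / 4 * ‖p‖ ^ 2 + 1 / α * ‖g‖ ^ 2 := by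
    have : α / 4 * ‖p‖ ^ 2 + 1 / α * ‖g‖ ^ 2 - ‖g‖ * ‖p‖ =
        (α * ‖p‖ / 2 - ‖g‖) ^ 2 / α := by field_simp; ring
    have h6 : 0 ≤ (α * ‖p‖ / 2 - ‖g‖) ^ 2 / α := by positivity
    linarith
  nlinarith [sq_nonneg (‖g‖ - ‖v‖)]

/-- The criterion is closed under convergence of `v` in `V` and of its projection in `H`. The
projections are bounded in `V` by `norm_sq_le_of_criterion`, so they converge weakly, and
quasi-coercivity makes the quadratic form weakly lower semicontinuous up to a term that is small
in `H`. -/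
theorem criterion_of_tendsto {j : V →L[𝕜] H} (hj : Function.Injective j)
    {b : V →L[𝕜] Antidual 𝕜 V} {g : Antidual 𝕜 V} {ω α : ℝ} (hα : 0 < α)
    (hc : ∀ u, α * ‖u‖ ^ 2 ≤ RCLike.re (b u u) + ω * ‖j u‖ ^ 2) {v p : ℕ → V} {v₀ p₀ : V}
    (hv : Tendsto v atTop (𝓝 v₀)) (hp : Tendsto (fun n => j (p n)) atTop (𝓝 (j p₀)))
    (h : ∀ n, RCLike.re (g (v n - p n)) ≤ RCLike.re (b (p n) (v n - p n))) :
    RCLike.re (g (v₀ - p₀)) ≤ RCLike.re (b p₀ (v₀ - p₀)) := by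
  have hbd : ∀ u v, ‖b u v‖ ≤ ‖b‖ * ‖u‖ * ‖v‖ := fun u v =>
    ((b u).le_opNorm v).trans (mul_le_mul_of_nonneg_right (b.le_opNorm u) (norm_nonneg _))
  obtain ⟨R, hR⟩ : ∃ R, ∀ n, ‖p n‖ ≤ R := by
    have h1 : Tendsto (fun n => (‖b‖ ^ 2 / α + 1 / 2) * ‖v n‖ ^ 2 + (1 / α + 1 / 2) * ‖g‖ ^ 2 +
        ω * ‖j (p n)‖ ^ 2) atTop (𝓝 ((‖b‖ ^ 2 / α + 1 / 2) * ‖v₀‖ ^ 2 +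
        (1 / α + 1 / 2) * ‖g‖ ^ 2 + ω * ‖j p₀‖ ^ 2)) :=
      (((hv.norm.pow 2).const_mul _).add_const _).add ((hp.norm.pow 2).const_mul _)
    obtain ⟨B, hB⟩ := h1.bddAbove_range
    refine ⟨√(B / (α / 2)), fun n => Real.le_sqrt_of_sq_le ?_⟩
    rw [le_div_iff₀ (by positivity), mul_comm]
    exact (norm_sq_le_of_criterion hα hbd hc (h n)).trans (hB ⟨n, rfl⟩)
  have wl := fun y => tendsto_linear_of_tendsto_image hj hR hp (b.flip y)
  have wa := tendsto_antilinear_of_tendsto_image hj hR hp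
  have l0 : Tendsto (fun n => b (p n) (v n - v₀)) atTop (𝓝 0) := by
    refine squeeze_zero_norm (a := fun n => ‖b‖ * R * ‖v n - v₀‖) (fun n => ?_) ?_
    · refine (hbd _ _).trans ?_
      gcongr
      exact hR n
    · simpa using (hv.sub_const v₀).norm.const_mul (‖b‖ * R)
  have l1 : Tendsto (fun n => RCLike.re (b (p n) (v n - v₀)) + RCLike.re (b (p n) v₀) -
      RCLike.re (b (p n) p₀) - RCLike.re (b p₀ (p n)) + RCLike.re (b p₀ p₀) +
      ω * ‖j (p n) - j p₀‖ ^ 2) atTop (𝓝 (RCLike.re (0 : 𝕜) + RCLike.re (b p₀ v₀) -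
      RCLike.re (b p₀ p₀) - RCLike.re (b p₀ p₀) + RCLike.re (b p₀ p₀) +
      ω * ‖j p₀ - j p₀‖ ^ 2)) := by
    have re := fun x => (RCLike.continuous_re (K := 𝕜)).tendsto x
    exact ((((((re _).comp l0).add ((re _).comp (wl v₀))).sub ((re _).comp (wl p₀))).sub
      ((re _).comp (wa (b p₀)))).add_const _).add (((hp.sub_const _).norm.pow 2).const_mul _)
  have l2 : Tendsto (fun n => RCLike.re (g (v n)) - RCLike.re (g (p n))) atTop
      (𝓝 (RCLike.re (g v₀) - RCLike.re (g p₀))) :=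
    ((RCLike.continuous_re.tendsto _).comp ((g.continuous.tendsto _).comp hv)).sub
      ((RCLike.continuous_re.tendsto _).comp (wa g))
  have h3 := le_of_tendsto_of_tendsto' l2 l1 fun n => by
    have c := hc (p n - p₀)
    have c0 : 0 ≤ α * ‖p n - p₀‖ ^ 2 := by positivity
    have hn := h n
    simp only [map_sub, sub_apply] at c hn ⊢
    linarith
  simp only [map_sub, map_zero, sub_self, norm_zero] at h3 ⊢
  linarith

end WeakConvergence

/-! ### Invariance of convex sets -/

section Invariance

open Filter Topology

/-- Gronwall's lemma for a nonnegative continuous function whose increments on the open interval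
`(0,T)` are bounded by a multiple of its integral. -/
theorem eq_zero_of_sub_le_integral {T k : ℝ} {ψ : ℝ → ℝ} (hc : Continuous ψ)
    (h0 : ∀ t, 0 ≤ ψ t) (hψ0 : ψ 0 = 0)
    (h : ∀ s t, 0 < s → s ≤ t → t < T → ψ t - ψ s ≤ k * ∫ x in s..t, ψ x)
    {t : ℝ} (ht : t ∈ Icc 0 T) : ψ t = 0 := by
  rcases ht.1.eq_or_lt with rfl | htpos
  · exact hψ0
  have hT : 0 < T := htpos.trans_le ht.2
  set Ψ : ℝ → ℝ := fun t => ∫ x in (0 : ℝ)..t, ψ x with hΨ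
  have hd : ∀ x, HasDerivAt Ψ (ψ x) x := fun x =>
    intervalIntegral.integral_hasDerivAt_right (hc.intervalIntegrable _ _)
      (hc.stronglyMeasurableAtFilter _ _) hc.continuousAt
  have Ψc : Continuous Ψ := continuous_iff_continuousAt.2 fun x => (hd x).continuousAt
  have qc : Continuous fun x => ψ x - k * Ψ x := by fun_prop
  have hq : ∀ s t, 0 < s → s ≤ t → t < T → ψ t - k * Ψ t ≤ ψ s - k * Ψ s := by
    intro s t hs hst ht
    have h1 := h s t hs hst ht
    rw [← intervalIntegral.integral_interval_sub_left (hc.intervalIntegrable 0 t)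
      (hc.intervalIntegrable 0 s)] at h1
    linarith
  have hq0 : ∀ t ∈ Ioo 0 T, ψ t ≤ k * Ψ t := by
    intro t ht
    have hsub : closure (Ioo 0 t) ⊆ {s | ψ t - k * Ψ t ≤ ψ s - k * Ψ s} :=
      closure_minimal (fun s hs => hq s t hs.1 hs.2.le ht.2) (isClosed_le continuous_const qc)
    rw [closure_Ioo ht.1.ne] at hsub
    have := hsub ⟨le_rfl, ht.1.le⟩
    simp only [mem_ofPred_eq, hψ0, hΨ, intervalIntegral.integral_same] at this
    linarith
  have hqT : Icc 0 T ⊆ {t | ψ t ≤ k * Ψ t} := by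
    rw [← closure_Ioo hT.ne]
    exact closure_minimal hq0 (isClosed_le hc (by fun_prop))
  -- with an integrating factor, `Ψ' ≤ k Ψ` forces `Ψ ≤ 0`
  have hexp : ∀ x, HasDerivAt (fun x => Real.exp (-k * x) * Ψ x)
      (Real.exp (-k * x) * (ψ x - k * Ψ x)) x := by
    intro x
    have h1 : HasDerivAt (fun x => Real.exp (-k * x)) (Real.exp (-k * x) * (-k * 1)) x :=
      ((hasDerivAt_id x).const_mul (-k)).exp
    refine (h1.mul (hd x)).congr_deriv ?_
    ring
  have hanti : AntitoneOn (fun x => Real.exp (-k * x) * Ψ x) (Icc 0 T) := by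
    refine antitoneOn_of_deriv_nonpos (convex_Icc _ _) (by fun_prop)
      (fun x _ => (hexp x).differentiableAt.differentiableWithinAt) fun x hx => ?_
    rw [(hexp x).deriv]
    have := hqT (interior_subset hx)
    exact mul_nonpos_of_nonneg_of_nonpos (Real.exp_pos _).le (sub_nonpos.2 this)
  have h1 := hanti ⟨le_rfl, hT.le⟩ ht ht.1
  have h2 : Ψ t ≤ 0 := by
    simp only [hΨ, intervalIntegral.integral_same, mul_zero] at h1
    exact nonpos_of_mul_nonpos_right h1 (Real.exp_pos _)
  have h3 : 0 ≤ Ψ t := intervalIntegral.integral_nonneg ht.1 fun x _ => h0 x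
  have h4 : Ψ t = 0 := le_antisymm h2 h3
  have h5 := hqT ht
  rw [mem_ofPred_eq, h4, mul_zero] at h5
  exact le_antisymm h5 (h0 t)

theorem MeasureTheory.MemLp.indicator_sq_integrable {E : Type*} [NormedAddCommGroup E] {T : ℝ}
    {f : ℝ → E} (hf : MemLp f 2 (volume.restrict (Ioo 0 T))) :
    Integrable ((Ioo 0 T).indicator f) volume ∧
    Integrable (fun x => ‖(Ioo 0 T).indicator f x‖ ^ 2) volume := by
  have : IsFiniteMeasure (volume.restrict (Ioo (0 : ℝ) T)) := ⟨by simp⟩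
  have h0 : IntegrableOn f (Ioo 0 T) volume := hf.integrable (by norm_num)
  refine ⟨h0.integrable_indicator measurableSet_Ioo, ?_⟩
  have h1 : IntegrableOn (fun x => ‖f x‖ ^ 2) (Ioo 0 T) volume := by
    exact hf.integrable_norm_pow two_ne_zero
  refine (h1.integrable_indicator measurableSet_Ioo).congr (Eventually.of_forall fun x => ?_)
  by_cases hx : x ∈ Ioo 0 T <;> simp [hx]

variable {𝕜 V H : Type*} [RCLike 𝕜]
  [NormedAddCommGroup V] [InnerProductSpace 𝕜 V]
  [NormedAddCommGroup H] [InnerProductSpace 𝕜 H]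

theorem toAntidual_sub (j : V →L[𝕜] H) (x y : H) :
    toAntidual j (x - y) = toAntidual j x - toAntidual j y := by
  ext v
  simp [inner_sub_right]

theorem norm_toAntidual_le (j : V →L[𝕜] H) (x : H) : ‖toAntidual j x‖ ≤ ‖j‖ * ‖x‖ := by
  refine ContinuousLinearMap.opNorm_le_bound _ (by positivity) fun v => ?_
  rw [toAntidual_apply]
  calc ‖inner 𝕜 (j v) x‖ ≤ ‖j v‖ * ‖x‖ := norm_inner_le_norm _ _
    _ ≤ ‖j‖ * ‖v‖ * ‖x‖ := by gcongr; exact j.le_opNorm v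
    _ = _ := by ring

theorem continuous_toAntidual (j : V →L[𝕜] H) : Continuous (toAntidual j) := by
  refine (LipschitzWith.of_dist_le_mul (K := ‖j‖₊) fun x y => ?_).continuous
  rw [dist_eq_norm, dist_eq_norm, ← toAntidual_sub]
  exact norm_toAntidual_le j _

/-- The exceptional null set of times in the criterion can be chosen independently of `v`: it is
enough to treat a dense sequence, since the criterion passes to limits by `criterion_of_tendsto`. -/
theorem ae_forall_criterion [CompleteSpace V] [TopologicalSpace.SeparableSpace V] [CompleteSpace H]
    {j : V →L[𝕜] H} (hj : Function.Injective j) {T : ℝ} {a : ℝ → V →L[𝕜] Antidual 𝕜 V}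
    (ha : IsNonautonomousClosedForm j T a) {f : ℝ → Antidual 𝕜 V} {p : V → V}
    (hp : Continuous fun v => j (p v))
    (h : ∀ v, ∀ᵐ t ∂volume.restrict (Ioo 0 T),
      RCLike.re (f t (v - p v)) ≤ RCLike.re (a t (p v) (v - p v))) :
    ∀ᵐ t ∂volume.restrict (Ioo 0 T), ∀ v,
      RCLike.re (f t (v - p v)) ≤ RCLike.re (a t (p v) (v - p v)) := by
  obtain ⟨ω, α, hα, hc⟩ := ha.quasiCoercive
  have h1 := ae_all_iff.2 fun n => h (TopologicalSpace.denseSeq V n)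
  filter_upwards [h1, ae_restrict_mem measurableSet_Ioo] with t h2 ht v
  obtain ⟨x, hx, hxv⟩ := mem_closure_iff_seq_limit.1
    ((TopologicalSpace.denseRange_denseSeq V).closure_range ▸ mem_univ v)
  refine criterion_of_tendsto hj hα (hc t ⟨ht.1.le, ht.2.le⟩) hxv (p := fun n => p (x n))
    ((hp.tendsto v).comp hxv) fun n => ?_
  obtain ⟨m, hm⟩ := hx n
  rw [← hm]
  exact h2 m

/-- A map into `V` is measurable as soon as it is measurable into `H`, because an injective
continuous map on a Polish space is a measurable embedding. -/
theorem measurable_lift [CompleteSpace V] [TopologicalSpace.SeparableSpace V]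
    [MeasurableSpace V] [BorelSpace V] {j : V →L[𝕜] H} (hj : Function.Injective j) {p : V → V}
    (hp : Continuous fun v => j (p v)) : Measurable p := by
  borelize H
  have : SecondCountableTopology V := UniformSpace.secondCountable_of_separable V
  have he : MeasurableEmbedding j := j.continuous.measurableEmbedding hj
  exact he.measurable_comp_iff.1 hp.measurable

/-- The integrand `Re ⟨u', u - Pu⟩` of the energy identity is at most a multiple of the squared
distance to the convex set: by `u' = f - 𝒜u` and the criterion for `v = u` it is bounded by
`-Re 𝔞(u - Pu, u - Pu)`, to which quasi-coercivity applies. -/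
theorem re_apply_sub_le_of_criterion {j : V →L[𝕜] H} {b : V →L[𝕜] Antidual 𝕜 V}
    {g g' : Antidual 𝕜 V} {ω α : ℝ} (hα : 0 < α)
    (hc : ∀ u, α * ‖u‖ ^ 2 ≤ RCLike.re (b u u) + ω * ‖j u‖ ^ 2) {v p : V}
    (h : RCLike.re (g (v - p)) ≤ RCLike.re (b p (v - p))) (he : g' + b v = g) :
    RCLike.re (g' (v - p)) ≤ |ω| * ‖j (v - p)‖ ^ 2 := by
  have h1 := hc (v - p)
  have h2 : 0 ≤ α * ‖v - p‖ ^ 2 := by positivity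
  have h3 : ω * ‖j (v - p)‖ ^ 2 ≤ |ω| * ‖j (v - p)‖ ^ 2 := by gcongr; exact le_abs_self ω
  have h4 : b (v - p) (v - p) = b v (v - p) - b p (v - p) := by rw [map_sub b, sub_apply]
  rw [← he, add_apply, map_add] at h
  rw [h4, map_sub (RCLike.re : 𝕜 →+ ℝ)] at h1
  linarith

/-- The lifted projection `p` preserves square integrability. No growth bound on `p` in the norm
of `V` is assumed; the criterion itself provides one, depending on `f t`. -/
theorem memLp_of_criterion [CompleteSpace V] [TopologicalSpace.SeparableSpace V]
    {j : V →L[𝕜] H} (hj : Function.Injective j) {T : ℝ} {a : ℝ → V →L[𝕜] Antidual 𝕜 V}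
    (ha : IsNonautonomousClosedForm j T a) {f : ℝ → Antidual 𝕜 V}
    (hf : MemLp f 2 (volume.restrict (Ioo 0 T))) {p : V → V}
    (hp : ∀ v w, ‖j (p v) - j (p w)‖ ≤ ‖j v - j w‖) {u : ℝ → V}
    (hu : MemLp u 2 (volume.restrict (Ioo 0 T)))
    (h : ∀ᵐ t ∂volume.restrict (Ioo 0 T), ∀ v,
      RCLike.re (f t (v - p v)) ≤ RCLike.re (a t (p v) (v - p v))) :
    MemLp (fun t => p (u t)) 2 (volume.restrict (Ioo 0 T)) := by
  have : IsFiniteMeasure (volume.restrict (Ioo (0 : ℝ) T)) := ⟨by simp⟩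
  have hpc : Continuous fun v => j (p v) := by
    refine (LipschitzWith.of_dist_le_mul (K := ‖j‖₊) fun x y => ?_).continuous
    rw [dist_eq_norm, dist_eq_norm]
    refine (hp x y).trans ?_
    rw [← map_sub]
    exact j.le_opNorm _
  obtain ⟨ω, α, hα, hc⟩ := ha.quasiCoercive
  obtain ⟨M, hM⟩ := ha.bounded
  have hmeas : AEStronglyMeasurable (fun t => p (u t)) (volume.restrict (Ioo 0 T)) := by
    borelize V
    have : SecondCountableTopology V := UniformSpace.secondCountable_of_separable V
    exact ((measurable_lift hj hpc).comp_aemeasurable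
      hu.aestronglyMeasurable.aemeasurable).aestronglyMeasurable
  have iu := (memLp_two_iff_integrable_sq_norm hu.1).1 hu
  have iff := (memLp_two_iff_integrable_sq_norm hf.1).1 hf
  rw [memLp_two_iff_integrable_sq_norm hmeas]
  have hbound : Integrable (fun t => (α / 2)⁻¹ * ((M ^ 2 / α + 1 / 2) * ‖u t‖ ^ 2 +
      (1 / α + 1 / 2) * ‖f t‖ ^ 2 + |ω| * (2 * ‖j‖ ^ 2 * ‖u t‖ ^ 2 + 2 * ‖j (p 0)‖ ^ 2)))
      (volume.restrict (Ioo 0 T)) :=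
    (((iu.const_mul _).add (iff.const_mul _)).add
      (((iu.const_mul _).add (integrable_const _)).const_mul _)).const_mul _
  refine hbound.mono' (hmeas.norm.pow 2) ?_
  filter_upwards [h, ae_restrict_mem measurableSet_Ioo] with t h1 ht
  have ht' : t ∈ Icc 0 T := ⟨ht.1.le, ht.2.le⟩
  have h2 := norm_sq_le_of_criterion hα (hM t ht') (hc t ht') (h1 (u t))
  have h3 : ‖j (p (u t))‖ ≤ ‖j‖ * ‖u t‖ + ‖j (p 0)‖ := by
    have e1 := hp (u t) 0
    rw [map_zero, sub_zero] at e1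
    have e2 := norm_sub_norm_le (j (p (u t))) (j (p 0))
    linarith [j.le_opNorm (u t)]
  have h4 : ‖j (p (u t))‖ ^ 2 ≤ 2 * ‖j‖ ^ 2 * ‖u t‖ ^ 2 + 2 * ‖j (p 0)‖ ^ 2 := by
    have := pow_le_pow_left₀ (norm_nonneg _) h3 2
    nlinarith [sq_nonneg (‖j‖ * ‖u t‖ - ‖j (p 0)‖)]
  have h5 : ω * ‖j (p (u t))‖ ^ 2 ≤
      |ω| * (2 * ‖j‖ ^ 2 * ‖u t‖ ^ 2 + 2 * ‖j (p 0)‖ ^ 2) :=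
    (mul_le_mul_of_nonneg_right (le_abs_self ω) (by positivity)).trans
      (mul_le_mul_of_nonneg_left h4 (abs_nonneg ω))
  rw [Real.norm_of_nonneg (by positivity), ← div_eq_inv_mul, le_div_iff₀ (by positivity)]
  linarith

end Invariance

theorem mainTheorem1 {𝕜 V H : Type*} [RCLike 𝕜]
    [NormedAddCommGroup V] [InnerProductSpace 𝕜 V] [CompleteSpace V]
    [TopologicalSpace.SeparableSpace V]
    [NormedAddCommGroup H] [InnerProductSpace 𝕜 H] [CompleteSpace H]
    [TopologicalSpace.SeparableSpace H]
    [NormedSpace ℝ H] [IsScalarTower ℝ 𝕜 H]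
    (j : V →L[𝕜] H) (hj_inj : Function.Injective j) (hj_dense : DenseRange j)
    (T : ℝ) (hT : 0 < T)
    (a : ℝ → V →L[𝕜] Antidual 𝕜 V) (ha : IsNonautonomousClosedForm j T a)
    (f : ℝ → Antidual 𝕜 V) (hf : MemLp f 2 (volume.restrict (Ioo 0 T)))
    (C : Set H) (hC_ne : C.Nonempty) (hC_closed : IsClosed C) (hC_convex : Convex ℝ C)
    (hPV : ∀ v : V, convexProj 𝕜 C (j v) ∈ range j)
    (hcrit : ∀ v p : V, j p = convexProj 𝕜 C (j v) →
      ∀ᵐ t ∂volume.restrict (Ioo 0 T),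
        RCLike.re (f t (v - p)) ≤ RCLike.re (a t p (v - p))) :
    IsInvariantFor j T a f C := by
  rintro u ⟨hu, u', hu', hweak, heq⟩
  have : IsFiniteMeasure (volume.restrict (Ioo (0 : ℝ) T)) := ⟨by simp⟩
  obtain ⟨Ui, Ui2⟩ := hu.indicator_sq_integrable
  obtain ⟨gi, gi2⟩ := hu'.indicator_sq_integrable
  set U : ℝ → V := (Ioo 0 T).indicator u with hU
  set g : ℝ → Antidual 𝕜 V := (Ioo 0 T).indicator u' with hg
  have gii := gi.locallyIntegrable.intervalIntegrable
  have Ueq : ∀ t ∈ Ioo 0 T, U t = u t := fun t ht => indicator_of_mem ht u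
  have hyi : IntegrableOn (fun t => toAntidual j (j (u t))) (Ioo 0 T) volume := by
    refine (((hu.integrable (by norm_num)).norm).const_mul (‖j‖ * ‖j‖)).mono'
      (((continuous_toAntidual j).comp j.continuous).comp_aestronglyMeasurable hu.1)
      (Filter.Eventually.of_forall fun t => ?_)
    refine (norm_toAntidual_le j _).trans ?_
    rw [mul_assoc]
    gcongr
    exact j.le_opNorm _
  obtain ⟨c, hc⟩ := hweak.exists_ae_eq_add_integral hT hyi (hu'.integrable (by norm_num))
  have hg0 : ∀ t ∈ Ioo 0 T, ∫ r in (0 : ℝ)..t, u' r = ∫ r in (0 : ℝ)..t, g r := by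
    intro t ht
    refine intervalIntegral.integral_congr_ae (Filter.Eventually.of_forall fun r hr => ?_)
    rw [uIoc_of_le ht.1.le] at hr
    exact (indicator_of_mem (show r ∈ Ioo 0 T from ⟨hr.1, hr.2.trans_lt ht.2⟩) u').symm
  set S : Set ℝ := {t | t ∈ Ioo 0 T ∧ toAntidual j (j (u t)) = c + ∫ r in (0 : ℝ)..t, u' r} with hS
  have hSae : ∀ᵐ t, t ∈ Ioo 0 T → t ∈ S := by
    filter_upwards [hc] with t h1 h2 using ⟨h2, h1 h2⟩
  have hinc : ∀ σ ∈ S, ∀ τ ∈ S, toAntidual j (j (U τ) - j (U σ)) = ∫ r in σ..τ, g r := by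
    intro σ hσ τ hτ
    rw [Ueq σ hσ.1, Ueq τ hτ.1, toAntidual_sub, hσ.2, hτ.2, hg0 σ hσ.1, hg0 τ hτ.1,
      ← intervalIntegral.integral_interval_sub_left (gii 0 τ) (gii 0 σ)]
    abel
  obtain ⟨w, hw, hwu⟩ := exists_continuous_representative j hT Ui.aestronglyMeasurable Ui2 gi gi2
    hSae hinc
  refine ⟨w, ⟨hw, ?_⟩, fun hw0 => ?_⟩
  · rw [ae_restrict_iff' measurableSet_Ioo]
    filter_upwards [hwu] with t h1 h2
    rw [h1 h2, Ueq t h2]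
  have hP := convexProj_spec (𝕜 := 𝕜) hC_ne hC_closed hC_convex
  set P : H → H := convexProj 𝕜 C
  have Pc : Continuous P := by
    refine (LipschitzWith.of_dist_le_mul (K := 1) fun x y => ?_).continuous
    rw [dist_eq_norm, dist_eq_norm, NNReal.coe_one, one_mul]
    exact (hP x).norm_sub_le (hP y)
  choose p hp using hPV
  have hcrit' := ae_forall_criterion hj_inj ha (p := p)
    (by simpa only [hp, Function.comp_def] using Pc.comp j.continuous) fun v => hcrit v (p v) (hp v)
  have hpL := memLp_of_criterion hj_inj ha hf (p := p)
    (fun v w => by rw [hp, hp]; exact (hP _).norm_sub_le (hP _)) hu hcrit'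
  obtain ⟨zi, zi2⟩ := (hu.sub hpL).indicator_sq_integrable
  set z : ℝ → V := (Ioo 0 T).indicator (u - fun t => p (u t)) with hz
  have zeq : ∀ t ∈ Ioo 0 T, z t = u t - p (u t) := fun t ht => indicator_of_mem ht _
  -- the extension of `w` by constants makes the distance function continuous on the whole line
  set W : ℝ → H := IccExtend hT.le ((Icc 0 T).domRestrict w) with hW
  have Wc : Continuous W := (continuousOn_iff_continuous_domRestrict.1 hw).Icc_extend'
  have Weq : ∀ t ∈ Icc 0 T, W t = w t := fun t ht => IccExtend_of_mem _ _ ht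
  set ψ : ℝ → ℝ := fun t => 1 / 2 * ‖W t - P (W t)‖ ^ 2 with hψ
  have ψc : Continuous ψ := by fun_prop
  have ψd : ∀ x, HasDerivAt (fun x => ∫ r in (0 : ℝ)..x, ψ r) (ψ x) x := fun x =>
    intervalIntegral.integral_hasDerivAt_right (ψc.intervalIntegrable _ _)
      (ψc.stronglyMeasurableAtFilter _ _) ψc.continuousAt
  obtain ⟨ω, α, hα, hcoer⟩ := ha.quasiCoercive
  set S' : Set ℝ := {t | t ∈ S ∧ W t = j (u t)} with hS'
  have hS'ae : ∀ᵐ t, t ∈ Ioo 0 T → t ∈ S' := by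
    filter_upwards [hSae, hwu] with t h1 h2 h3
    exact ⟨h1 h3, by rw [Weq t ⟨h3.1.le, h3.2.le⟩, h2 h3, Ueq t h3]⟩
  have jz : ∀ t ∈ S', j (z t) = W t - P (W t) := by
    intro t ht
    rw [zeq t ht.1.1, map_sub, hp, ht.2]
  have energy : ∀ s t, 0 < s → s ≤ t → t < T → ψ t - ψ s ≤ 2 * |ω| * ∫ x in s..t, ψ x := by
    intro s t hs hst ht
    rw [energy_identity ψc.locallyIntegrable gi gi2 zi.aestronglyMeasurable zi2 hS'ae
      (fun σ hσ τ hτ => ?_) hs hst ht (ψd s) (ψd t), ← intervalIntegral.integral_const_mul,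
      intervalIntegral.integral_of_le hst, intervalIntegral.integral_of_le hst]
    · refine setIntegral_mono_on_ae (Antidual.integrable_re_apply gi.aestronglyMeasurable gi2
        zi.aestronglyMeasurable zi2).integrableOn
        ((ψc.intervalIntegrable s t).const_mul _).1 measurableSet_Ioc ?_
      filter_upwards [hS'ae, (ae_restrict_iff' measurableSet_Ioo).1 hcrit',
        (ae_restrict_iff' measurableSet_Ioo).1 heq] with τ h1 h2 h3 hτ
      have hτ' : τ ∈ Ioo 0 T := ⟨hs.trans hτ.1, hτ.2.trans_lt ht⟩
      have h4 := re_apply_sub_le_of_criterion hα (hcoer τ ⟨hτ'.1.le, hτ'.2.le⟩)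
        (h2 hτ' (u τ)) (h3 hτ')
      rw [← zeq τ hτ', jz τ (h1 hτ')] at h4
      rw [hg, indicator_of_mem hτ']
      refine h4.trans (le_of_eq ?_)
      simp only [hψ]
      ring
    · rw [← hinc σ hσ.1 τ hτ.1, toAntidual_apply, jz τ hτ, Ueq σ hσ.1.1, Ueq τ hτ.1.1, ← hσ.2,
        ← hτ.2]
      exact (hP _).half_sq_dist_sub_le (hP _)
  intro t ht
  have h1 : ψ 0 = 0 := by
    have h2 : P (w 0) = w 0 := (hP (w 0)).unique
      ⟨hw0, fun y _ => by rw [sub_self, inner_zero_left, map_zero]⟩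
    simp only [hψ, Weq 0 ⟨le_rfl, hT.le⟩, h2, sub_self, norm_zero]
    norm_num
  have h2 := eq_zero_of_sub_le_integral ψc (fun x => by positivity) h1 energy ht
  have h3 : w t - P (w t) = 0 := by
    simp only [hψ, Weq t ht] at h2
    have : ‖w t - P (w t)‖ ^ 2 = 0 := by linarith
    exact norm_eq_zero.1 (pow_eq_zero_iff two_ne_zero |>.1 this)
  rw [sub_eq_zero.1 h3]
  exact (hP (w t)).1
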